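/- \textbf{Corollary (Stability Theorem).} Let $D$ be a division algebra finite-dimensional over its center $Z(D)$, and let $\tau$ be a unitary involution on $D$, i.e. a ring anti-automorphism of $D$ with $\tau^2=\mathrm{id}$ and $\tau|_{Z(D)}\neq \mathrm{id}$. For such a pair put $$\Sigma_\tau(D)=\langle a\in D^*\mid \tau(a)=a\rangle,\qquad \Sigma'_\tau(D)=\{a\in D^*\mid \tau(\mathrm{Nrd}_D(a))=\mathrm{Nrd}_D(a)\},\qquad \mathrm{SK}_1(D,\tau)=\Sigma'_\tau(D)/\Sigma_\tau(D),$$ where $\mathrm{Nrd}_D$ is the reduced norm of $D$ over $Z(D)$. Let $D(x)$ be the rational division algebra over $D$, i.e. the quotient division ring of the polynomial ring $D[x]$ in a variable $x$ commuting with $D$, and let $\tau'$ be the canonical extension of $\tau$ to an involution of $D(x)$, with $\tau'|_D=\tau$ and $\tau'(x)=x$. Then there is an isomorphism of groups $$\mathrm{SK}_1(D,\tau)\;\cong\;\mathrm{SK}_1(D(x),\tau').$$ -/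

import Mathlib

open Polynomial nonZeroDivisors TensorProduct

section ReducedNorm

/-- A central division algebra stays simple under extension of the base field. -/
theorem isSimpleRing_tensor_field (K D L : Type*) [Field K] [DivisionRing D] [Algebra K D]
    (hc : ∀ d : D, (∀ e : D, e * d = d * e) → ∃ k : K, algebraMap K D k = d)
    [Field L] [Algebra K L] : IsSimpleRing (D ⊗[K] L) := by
  classical
  let b := Module.Basis.ofVectorSpace K L
  let B := Algebra.TensorProduct.basis D b
  have hl : ∀ (d : D) (x : D ⊗[K] L) i, B.repr ((d ⊗ₜ[K] (1 : L)) * x) i = d * B.repr x i := by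
    intro d x i
    have : (d ⊗ₜ[K] (1 : L)) * x = d • x := by
      induction x with
      | zero => simp
      | tmul a m => simp [TensorProduct.smul_tmul']
      | add x y hx hy => rw [mul_add, hx, hy, smul_add]
    rw [this]; simp
  have hr : ∀ (d : D) (x : D ⊗[K] L) i, B.repr (x * (d ⊗ₜ[K] (1 : L))) i = B.repr x i * d := by
    intro d x i
    induction x with
    | zero => simp
    | tmul a m =>
      simp only [B, Algebra.TensorProduct.tmul_mul_tmul, mul_one,
        Algebra.TensorProduct.basis_repr_tmul, Finsupp.smul_apply, Finsupp.mapRange_apply,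
        smul_eq_mul, mul_assoc, Algebra.commutes]
    | add x y hx hy => rw [add_mul]; simp [hx, hy, add_mul]
  have hbig : ∀ I : TwoSidedIdeal (D ⊗[K] L), I ≠ ⊥ → I = ⊤ := by
    intro I hI
    have hex : ∃ n, ∃ x ∈ I, x ≠ 0 ∧ (B.repr x).support.card = n := by
      by_contra! h
      refine hI (le_bot_iff.1 fun x hx => ?_)
      by_contra hx0
      exact h _ x hx (by rintro rfl; exact hx0 (zero_mem _)) rfl
    obtain ⟨x, hxI, hx0, hxn⟩ := Nat.find_spec hex
    have hmin := fun m => Nat.find_min (H := hex) (m := m)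
    rw [← hxn] at hmin
    obtain ⟨j, hj⟩ : ∃ j, B.repr x j ≠ 0 := by
      by_contra! h
      exact hx0 (B.repr.map_eq_zero_iff.1 (Finsupp.ext h))
    let y := ((B.repr x j)⁻¹ ⊗ₜ[K] (1 : L)) * x
    have hyI : y ∈ I := I.mul_mem_left _ _ hxI
    have hyr : ∀ i, B.repr y i = (B.repr x j)⁻¹ * B.repr x i := hl _ x
    have hyj : B.repr y j = 1 := by rw [hyr, inv_mul_cancel₀ hj]
    have hcomm : ∀ d : D, (d ⊗ₜ[K] (1 : L)) * y - y * (d ⊗ₜ[K] (1 : L)) = 0 := by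
      intro d
      by_contra hne
      refine hmin _ ?_ ⟨_, I.sub_mem (I.mul_mem_left (d ⊗ₜ[K] (1 : L)) _ hyI)
        (I.mul_mem_right _ (d ⊗ₜ[K] (1 : L)) hyI), hne, rfl⟩
      refine Finset.card_lt_card ((Finset.ssubset_iff_of_subset ?_).2
        ⟨j, by simpa using hj, ?_⟩)
      · intro i hi
        rw [Finsupp.mem_support_iff] at hi ⊢
        intro h0
        apply hi
        rw [map_sub, Finsupp.sub_apply, hl, hr, hyr, h0]; simp
      · rw [Finsupp.notMem_support_iff, map_sub, Finsupp.sub_apply, hl, hr, hyj]; simp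
    have hk : ∀ i, ∃ k : K, algebraMap K D k = B.repr y i := fun i => hc _ fun e => by
      have := congrArg (fun t => B.repr t i) (hcomm e)
      simp only [map_sub, Finsupp.sub_apply, hl, hr, map_zero, Finsupp.zero_apply] at this
      exact sub_eq_zero.1 this
    choose k hk using hk
    have hk0 : ∀ i ∉ (B.repr y).support, k i = 0 := by
      intro i hi
      rw [Finsupp.notMem_support_iff, ← hk, map_eq_zero] at hi
      exact hi
    let l : L := ∑ i ∈ (B.repr y).support, k i • b i
    have hyl : y = 1 ⊗ₜ[K] l := by
      rw [← B.linearCombination_repr y, Finsupp.linearCombination_apply, Finsupp.sum,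
        TensorProduct.tmul_sum]
      refine Finset.sum_congr rfl fun i _ => ?_
      rw [← hk, Algebra.TensorProduct.basis_apply, TensorProduct.tmul_smul, algebraMap_smul]
    have hl0 : l ≠ 0 := by
      intro h
      rw [hyl, h, TensorProduct.tmul_zero] at hyj
      simp at hyj
    have h1 : (1 : D ⊗[K] L) ∈ I := by
      have := I.mul_mem_left (1 ⊗ₜ[K] l⁻¹) _ hyI
      rwa [hyl, Algebra.TensorProduct.tmul_mul_tmul, inv_mul_cancel₀ hl0, one_mul] at this
    exact I.one_mem_iff.1 h1
  have : Nonempty (Module.Basis.ofVectorSpaceIndex K L) := b.index_nonempty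
  have : Nontrivial (D ⊗[K] L) := B.repr.toEquiv.nontrivial
  exact ⟨⟨fun I => or_iff_not_imp_left.2 (hbig I)⟩⟩

/-- A division ring finite-dimensional over its center is split by the algebraic closure of the
center. -/
theorem exists_splitting (D : Type*) [DivisionRing D] [FiniteDimensional (Subring.center D) D] :
    ∃ n : ℕ, Nonempty ((AlgebraicClosure (Subring.center D)) ⊗[Subring.center D] D
      ≃ₐ[AlgebraicClosure (Subring.center D)]
        Matrix (Fin n) (Fin n) (AlgebraicClosure (Subring.center D))) := by
  have h1 : IsSimpleRing (D ⊗[Subring.center D] AlgebraicClosure (Subring.center D)) :=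
    isSimpleRing_tensor_field _ _ _ fun d hd => ⟨⟨d, Subring.mem_center_iff.2 hd⟩, rfl⟩
  have h2 : IsSimpleRing (AlgebraicClosure (Subring.center D) ⊗[Subring.center D] D) :=
    .of_ringEquiv (Algebra.TensorProduct.comm (Subring.center D) D
      (AlgebraicClosure (Subring.center D))).toRingEquiv h1
  obtain ⟨n, -, h⟩ := IsSimpleRing.exists_algEquiv_matrix_of_isAlgClosed
    (AlgebraicClosure (Subring.center D)) (AlgebraicClosure (Subring.center D) ⊗[Subring.center D] D)
  exact ⟨n, h⟩

variable (D : Type*) [DivisionRing D] [FiniteDimensional (Subring.center D) D]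

/-- The degree `n` of a splitting `L ⊗ D ≅ Mₙ(L)`, i.e. the index of `D`. -/
noncomputable def splittingDegree : ℕ := (exists_splitting D).choose

/-- An isomorphism of `L`-algebras `L ⊗ D ≅ Mₙ(L)`, where `L` is the algebraic closure of the
center of `D`. -/
noncomputable def splitting :
    (AlgebraicClosure (Subring.center D)) ⊗[Subring.center D] D
      ≃ₐ[AlgebraicClosure (Subring.center D)]
        Matrix (Fin (splittingDegree D)) (Fin (splittingDegree D))
          (AlgebraicClosure (Subring.center D)) :=
  (exists_splitting D).choose_spec.some

/-- The reduced norm of a division ring `D` finite-dimensional over its center `K`: the determinant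
of the image of `1 ⊗ a` under an isomorphism `L ⊗ D ≅ Mₙ(L)`, with `L` an algebraic closure of `K`.
It does not depend on the isomorphism, and its values lie in `K`, which is viewed here inside `L`. -/
noncomputable def nrd : D →* AlgebraicClosure (Subring.center D) where
  toFun a := (splitting D (1 ⊗ₜ a)).det
  map_one' := by
    rw [← Algebra.TensorProduct.one_def, map_one, Matrix.det_one]
  map_mul' a b := by
    rw [← Matrix.det_mul, ← map_mul, Algebra.TensorProduct.tmul_mul_tmul, one_mul]

end ReducedNorm

section UnitarySK1

/-- An involution is unitary (of the second kind) if it is not the identity on the center. -/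
def RingInvo.IsUnitary {D : Type*} [DivisionRing D] (τ : RingInvo D) : Prop :=
  ∃ z ∈ Subring.center D, (τ z).unop ≠ z

variable {D : Type*} [DivisionRing D]

/-- `Σ_τ(D)`: the subgroup of `D*` generated by the symmetric units. -/
def unitarySigma (τ : RingInvo D) : Subgroup Dˣ :=
  Subgroup.closure {a : Dˣ | (τ (a : D)).unop = a}

instance unitarySigma_normal (τ : RingInvo D) : (unitarySigma τ).Normal := by
  have hinv : ∀ a : D, (τ (τ a).unop).unop = a := τ.involution
  let t : Dˣ → Dˣ := fun g =>
    ⟨(τ (g : D)).unop, (τ ((g⁻¹ : Dˣ) : D)).unop,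
      by rw [← MulOpposite.unop_mul, ← map_mul, Units.inv_mul, map_one, MulOpposite.unop_one],
      by rw [← MulOpposite.unop_mul, ← map_mul, Units.mul_inv, map_one, MulOpposite.unop_one]⟩
  have ht : ∀ g : Dˣ, ((t g : Dˣ) : D) = (τ (g : D)).unop := fun g => rfl
  refine ⟨fun x hx g => ?_⟩
  induction hx using Subgroup.closure_induction with
  | mem s hs =>
    have hs' : (τ (s : D)).unop = s := hs
    have h1 : g * s * t g ∈ unitarySigma τ := Subgroup.subset_closure <| by
      simp [ht, hs', hinv, mul_assoc]
    have h2 : g * t g ∈ unitarySigma τ := Subgroup.subset_closure <| by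
      simp [ht, hinv]
    have h3 : g * s * g⁻¹ = (g * s * t g) * (g * t g)⁻¹ := by group
    rw [h3]
    exact mul_mem h1 (inv_mem h2)
  | one => simp
  | mul x y _ _ hx hy =>
    have h : g * (x * y) * g⁻¹ = (g * x * g⁻¹) * (g * y * g⁻¹) := by group
    rw [h]; exact mul_mem hx hy
  | inv x _ hx =>
    have h : g * x⁻¹ * g⁻¹ = (g * x * g⁻¹)⁻¹ := by group
    rw [h]; exact inv_mem hx

variable [FiniteDimensional (Subring.center D) D]

/-- `Σ'_τ(D)`: the group of the units of `D` whose reduced norm is symmetric, i.e. is an element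
`c` of the center of `D` with `τ(c) = c`. -/
def unitarySigma' (τ : RingInvo D) : Subgroup Dˣ where
  carrier := {a : Dˣ | ∃ c : Subring.center D, (τ (c : D)).unop = c ∧
    algebraMap (Subring.center D) (AlgebraicClosure (Subring.center D)) c = nrd D a}
  one_mem' := ⟨1, by simp, by simp⟩
  mul_mem' := by
    rintro a b ⟨c, hc, hc'⟩ ⟨d, hd, hd'⟩
    refine ⟨c * d, ?_, by rw [map_mul, hc', hd', Units.val_mul, map_mul]⟩
    rw [Subring.coe_mul, map_mul, MulOpposite.unop_mul, hc, hd]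
    exact Subring.mem_center_iff.1 c.2 d
  inv_mem' := by
    rintro a ⟨c, hc, hc'⟩
    refine ⟨c⁻¹, ?_, ?_⟩
    · rw [Subring.center.coe_inv, map_inv₀, MulOpposite.unop_inv, hc]
    · rw [map_inv₀, hc']
      exact inv_eq_of_mul_eq_one_right (by rw [← map_mul, Units.mul_inv, map_one])

/-- The unitary `SK₁(D, τ) = Σ'_τ(D) / Σ_τ(D)`. (For a unitary involution `τ` the group `Σ_τ(D)`
is contained in `Σ'_τ(D)`.) -/
abbrev UnitarySK1 (τ : RingInvo D) : Type _ :=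
  unitarySigma' τ ⧸ (unitarySigma τ).subgroupOf (unitarySigma' τ)

end UnitarySK1

section RationalFunctions
variable (D : Type*) [DivisionRing D]

/-- The polynomial ring over a division ring satisfies the left Ore condition. -/
theorem exists_mul_eq_mul_polynomial (r s : D[X]) (hs : s ≠ 0) :
    ∃ r' s' : D[X], s' ≠ 0 ∧ s' * r = r' * s := by
  set n := s.natDegree
  set m := r.natDegree
  by_cases hr : r = 0
  · exact ⟨0, 1, one_ne_zero, by simp [hr]⟩
  let F : (degreeLT D (n + 1) × degreeLT D (m + 1)) →ₗ[D] D[X] :=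
    { toFun := fun p => (p.1 : D[X]) * r - (p.2 : D[X]) * s
      map_add' := fun p q => by
        simp only [Prod.fst_add, Prod.snd_add, Submodule.coe_add, add_mul]; abel
      map_smul' := fun c p => by
        simp [smul_sub, smul_mul_assoc] }
  have hF : ∀ p, F p ∈ degreeLT D (n + m + 1) := by
    rintro ⟨⟨a, ha⟩, ⟨b, hb⟩⟩
    rw [degreeLT_succ_eq_degreeLE, mem_degreeLE, ← natDegree_le_iff_degree_le] at ha hb ⊢
    refine (natDegree_sub_le _ _).trans (max_le ?_ ?_)
    · exact natDegree_mul_le.trans (by simp only; omega)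
    · exact natDegree_mul_le.trans (by simp only; omega)
  have e : ∀ k, Module.finrank D (degreeLT D k) = k := fun k => by
    rw [(degreeLTEquiv D k).finrank_eq]; simp
  have fin : ∀ k, Module.Finite D (degreeLT D k) := fun k =>
    Module.Finite.equiv (degreeLTEquiv D k).symm
  have hni : ¬ Function.Injective (F.codRestrict _ hF) := fun hi => by
    have := LinearMap.finrank_le_finrank_of_injective hi
    rw [Module.finrank_prod, e, e, e] at this
    omega
  rw [← LinearMap.ker_eq_bot, LinearMap.ker_codRestrict, ← ne_eq, Submodule.ne_bot_iff] at hni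
  obtain ⟨⟨⟨a, ha⟩, ⟨b, hb⟩⟩, h0, hne⟩ := hni
  have h1 : a * r = b * s := sub_eq_zero.1 h0
  refine ⟨b, a, ?_, h1⟩
  rintro rfl
  rw [zero_mul] at h1
  rcases mul_eq_zero.1 h1.symm with rfl | h
  · exact hne rfl
  · exact hs h

noncomputable instance polynomialOreSet : OreLocalization.OreSet (D[X]⁰) :=
  Classical.choice <| OreLocalization.nonempty_oreSet_iff_of_noZeroDivisors.2 fun r s => by
    obtain ⟨r', s', hs', h⟩ :=
      exists_mul_eq_mul_polynomial D r s (nonZeroDivisors.ne_zero s.2)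
    exact ⟨r', ⟨s', mem_nonZeroDivisors_of_ne_zero hs'⟩, h⟩

/-- The rational division algebra `D(x)`: the quotient division ring of the polynomial ring `D[x]`,
in which the variable `x` commutes with the elements of `D`. -/
def RatDiv : Type _ := OreLocalization (D[X]⁰) D[X]

noncomputable instance : DivisionRing (RatDiv D) :=
  inferInstanceAs (DivisionRing (OreLocalization (D[X]⁰) D[X]))

variable {D}
namespace RatDiv

/-- The embedding `D[x] → D(x)`. -/
noncomputable def ofPoly : D[X] →+* RatDiv D :=
  (OreLocalization.numeratorRingHom : D[X] →+* OreLocalization (D[X]⁰) D[X])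

theorem ofPoly_injective : Function.Injective (ofPoly (D := D)) :=
  OreLocalization.numeratorHom_inj inf_le_left

theorem exists_eq (q : RatDiv D) :
    ∃ r s : D[X], s ≠ 0 ∧ q = (ofPoly s)⁻¹ * ofPoly r := by
  induction q using OreLocalization.ind with | _ r s
  refine ⟨r, s, nonZeroDivisors.ne_zero s.2, ?_⟩
  have h0 : ofPoly (s : D[X]) ≠ 0 := by
    rw [ne_eq, map_eq_zero_iff _ ofPoly_injective]; exact nonZeroDivisors.ne_zero s.2
  exact (eq_inv_mul_iff_mul_eq₀ h0).2 OreLocalization.mul_cancel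

/-- The involution `∑ dᵢ xⁱ ↦ ∑ τ(dᵢ) xⁱ` of `D[x]`, as a homomorphism to the opposite ring. -/
noncomputable def polyHom (τ : RingInvo D) : D[X] →+* D[X]ᵐᵒᵖ :=
  ((opRingEquiv D).symm : Dᵐᵒᵖ[X] →+* D[X]ᵐᵒᵖ).comp (mapRingHom (τ.toRingEquiv : D →+* Dᵐᵒᵖ))

theorem polyHom_C (τ : RingInvo D) (d : D) :
    polyHom τ (C d) = MulOpposite.op (C (τ d).unop) := by
  simp [polyHom]; rfl

theorem polyHom_X (τ : RingInvo D) : polyHom τ X = MulOpposite.op X := by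
  simp [polyHom]

theorem polyHom_polyHom (τ : RingInvo D) (p : D[X]) :
    (polyHom τ (polyHom τ p).unop).unop = p := by
  induction p using Polynomial.induction_on' with
  | add p q hp hq => simp [hp, hq]
  | monomial n a =>
    simp [← C_mul_X_pow_eq_monomial, polyHom_C, polyHom_X, X_pow_mul]

/-- The extension of `polyHom τ` to the quotient division ring. -/
noncomputable def invHom (τ : RingInvo D) : RatDiv D →+* (RatDiv D)ᵐᵒᵖ :=
  OreLocalization.universalHom (T := (RatDiv D)ᵐᵒᵖ) (ofPoly.op.comp (polyHom τ))
    (IsUnit.liftRight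
      (((ofPoly.op.comp (polyHom τ) : D[X] →+* (RatDiv D)ᵐᵒᵖ) : D[X] →* (RatDiv D)ᵐᵒᵖ).comp
        (D[X]⁰).subtype) fun s => by
        rw [isUnit_iff_ne_zero]
        intro h
        have h1 : ofPoly (polyHom τ s).unop = 0 := MulOpposite.op_injective h
        rw [map_eq_zero_iff _ ofPoly_injective] at h1
        have h2 := polyHom_polyHom τ s
        rw [h1, map_zero] at h2
        exact nonZeroDivisors.ne_zero s.2 h2.symm)
    fun _ => rfl

theorem invHom_ofPoly (τ : RingInvo D) (p : D[X]) :
    invHom τ (ofPoly p) = MulOpposite.op (ofPoly (polyHom τ p).unop) :=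
  OreLocalization.universalHom_commutes _ _ _

/-- The canonical extension `τ'` of an involution `τ` of `D` to `D(x)`: it is the (unique)
involution of `D(x)` with `τ'(d) = τ(d)` for `d ∈ D` and `τ'(x) = x`. -/
noncomputable def extInvo (τ : RingInvo D) : RingInvo (RatDiv D) :=
  RingInvo.mk' (invHom τ) fun q => by
    obtain ⟨r, s, -, rfl⟩ := exists_eq q
    simp [invHom_ofPoly, polyHom_polyHom]

theorem extInvo_C (τ : RingInvo D) (d : D) :
    extInvo τ (ofPoly (C d)) = MulOpposite.op (ofPoly (C (τ d).unop)) := by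
  refine (invHom_ofPoly τ _).trans ?_
  rw [polyHom_C]; rfl

theorem extInvo_X (τ : RingInvo D) :
    extInvo τ (ofPoly X) = MulOpposite.op (ofPoly X) := by
  refine (invHom_ofPoly τ _).trans ?_
  rw [polyHom_X]; rfl

theorem ofPoly_mem_center {p : D[X]} (hp : p ∈ Subring.center D[X]) :
    ofPoly p ∈ Subring.center (RatDiv D) := by
  rw [Subring.mem_center_iff] at hp ⊢
  intro q
  obtain ⟨r, s, hs, rfl⟩ := exists_eq q
  have h : ∀ t, Commute (ofPoly t) (ofPoly p) := fun t => by
    rw [commute_iff_eq, ← map_mul, ← map_mul, hp]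
  exact ((h s).inv_left₀.mul_left (h r)).eq

/-- If `D` is finite-dimensional over its center, then so is `D(x)`. -/
instance finiteDimensional_center [FiniteDimensional (Subring.center D) D] :
    FiniteDimensional (Subring.center (RatDiv D)) (RatDiv D) := by
  let Z := Subring.center (RatDiv D)
  let b := Module.finBasis (Subring.center D) D
  let A : Submodule Z (RatDiv D) := Submodule.span Z (Set.range fun i => ofPoly (C (b i)))
  have hfin : FiniteDimensional Z A := FiniteDimensional.span_of_finite Z (Set.finite_range _)
  have hC : ∀ d, ofPoly (C d) ∈ A := fun d => by
    rw [← b.sum_repr d, map_sum, map_sum]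
    refine A.sum_mem fun i _ => ?_
    have hz : ofPoly (C ((b.repr d i : Subring.center D) : D)) ∈ Z :=
      ofPoly_mem_center (Subring.mem_center_iff.2 fun g => by
        ext n
        rw [coeff_mul_C, coeff_C_mul]
        exact Subring.mem_center_iff.1 (b.repr d i).2 _)
    rw [Subring.smul_def, smul_eq_mul, C_mul, map_mul]
    exact A.smul_mem ⟨_, hz⟩ (Submodule.subset_span ⟨i, rfl⟩)
  have hX : ∀ n, ofPoly (X ^ n : D[X]) ∈ Z := fun n =>
    ofPoly_mem_center (Subring.mem_center_iff.2 fun g => (X_pow_mul).symm)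
  have hP : ∀ p, ofPoly p ∈ A := fun p => by
    induction p using Polynomial.induction_on' with
    | add p q hp hq => rw [map_add]; exact A.add_mem hp hq
    | monomial n a =>
      rw [← C_mul_X_pow_eq_monomial, ← X_pow_mul, map_mul]
      exact A.smul_mem ⟨_, hX n⟩ (hC a)
  have hmul : ∀ p, ∀ a ∈ A, ofPoly p * a ∈ A := fun p a ha => by
    induction ha using Submodule.span_induction with
    | mem x hx =>
      obtain ⟨i, rfl⟩ := hx
      rw [← map_mul]
      exact hP _
    | zero => simp
    | add x y _ _ hx hy => rw [mul_add]; exact A.add_mem hx hy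
    | smul z x _ hx => rw [mul_smul_comm]; exact A.smul_mem z hx
  refine ⟨⟨(Set.finite_range fun i => ofPoly (C (b i))).toFinset, ?_⟩⟩
  rw [Set.Finite.coe_toFinset, eq_top_iff]
  rintro q -
  obtain ⟨r, s, hs, rfl⟩ := exists_eq q
  have hs0 : ofPoly s ≠ 0 := by rwa [ne_eq, map_eq_zero_iff _ ofPoly_injective]
  let f : A →ₗ[Z] A := (LinearMap.mulLeft Z (ofPoly s)).restrict (hmul s)
  have hf : Function.Injective f := fun x y h =>
    Subtype.ext (mul_left_cancel₀ hs0 (congrArg Subtype.val h))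
  obtain ⟨a, ha⟩ := LinearMap.injective_iff_surjective.1 hf ⟨ofPoly r, hP r⟩
  have ha' : ofPoly s * (a : RatDiv D) = ofPoly r := congrArg Subtype.val ha
  rw [← ha', inv_mul_cancel_left₀ hs0]
  exact a.2

/-- The canonical extension of a unitary involution is unitary. -/
theorem extInvo_unitary {τ : RingInvo D} (hτ : τ.IsUnitary) : (extInvo τ).IsUnitary := by
  obtain ⟨z, hz, hne⟩ := hτ
  refine ⟨ofPoly (C z), ofPoly_mem_center (Subring.mem_center_iff.2 fun g => ?_), fun h => hne ?_⟩
  · ext n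
    rw [coeff_mul_C, coeff_C_mul]
    exact Subring.mem_center_iff.1 hz _
  · rw [extInvo_C] at h
    exact C_injective (ofPoly_injective h)

end RatDiv
end RationalFunctions

/-!
The isomorphism is induced by the inclusion of `D` in `E = D(x)`. Write `K` for the center of `D`
and `Σ` for the group generated by the symmetric elements.

*Well-definedness.* The reduced norm of an element of `D` is the same in `D` and in `E`, and it is
symmetric if the element is. Both facts rest on the reduced characteristic polynomial being a power
of the minimal polynomial (`exists_redCharpoly_eq_minpoly_pow`), so that it has coefficients in the
center. It is determined by its `n`-th power, where `n` is the index, and this power is the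
characteristic polynomial of left multiplication (`redCharpoly_pow`). A basis of `D` over `K` is
also a basis of `E` over its center (`RatDiv.basis`), so the characteristic polynomials of left
multiplication by an element of `D` on `D` and on `E` agree.

*Injectivity.* Taking leading coefficients is a homomorphism `E* → D*` which is the identity on `D*`
and maps symmetric elements to symmetric elements (`RatDiv.leadHom`).

*Surjectivity.* The group `E* / Σ` is commutative (`RingInvo.unitarySigma_mk_comm`), and
`τ(a)` is inverse to `a` in it because `a τ(a)` is symmetric. Hence every class contains a
polynomial. Let `f` be a polynomial of least degree in the class of an element with symmetric
reduced norm. The norm of `f` over `K[x]` is then symmetric, and if `f` is not constant, it has an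
irreducible factor `π`, which comes with a nonconstant left factor `p` of `f` dividing `π`. If `π`
is symmetric, write `π = p p'`. The ring `D[x] / (π)` is prime, so there is a symmetric element of
the form `τ(p') y p'` not divisible by `π`, and its remainder modulo `π` is `q p'` with `q` of
smaller degree than `p`; in `E* / Σ` both `p` and `q` are inverse to `p'`, and `p` can be replaced
by `q` in `f`. If `π` is not symmetric, then `τ(π)` divides the norm of the other factor of `f`,
so that `f` begins with a product `p r`, where `r` divides `τ(π)`. Now `p` and `τ(r)` divide the
same irreducible `π`, which gives a relation `v p = τ(r) u` with `v`, `u` of smaller degree than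
`r`, `p` (`exists_mul_eq_mul_of_dvd`). Therefore `p r` can be replaced by `u τ(v)`. In both cases the degree
drops (`exists_natDegree_lt_of_symmetric_polyNorm`), so `f` must be constant.
-/

/-! ### Commutators are products of symmetric elements -/

namespace RingInvo

section Ring
variable {R : Type*} [Ring R] (τ : RingInvo R)

/-- An involution viewed as an additive map of the ring to itself; it reverses products. -/
def conj : R →+ R where
  toFun a := (τ a).unop
  map_zero' := by simp
  map_add' a b := by simp

theorem conj_def (a : R) : τ.conj a = (τ a).unop := rfl

@[simp] theorem conj_mul (a b : R) : τ.conj (a * b) = τ.conj b * τ.conj a := by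
  simp [conj_def]

@[simp] theorem conj_one : τ.conj 1 = 1 := by simp [conj_def]

@[simp] theorem conj_conj (a : R) : τ.conj (τ.conj a) = a := τ.involution a

theorem conj_mem_center {z : R} (hz : z ∈ Subring.center R) : τ.conj z ∈ Subring.center R := by
  rw [Subring.mem_center_iff] at hz ⊢
  intro g
  have := congrArg τ.conj (hz (τ.conj g))
  simpa using this.symm

/-- The ring endomorphism of the center induced by an involution. -/
def centerConj : Subring.center R →+* Subring.center R where
  toFun z := ⟨τ.conj z, τ.conj_mem_center z.2⟩
  map_zero' := by ext; simp
  map_one' := by ext; simp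
  map_add' a b := by ext; simp
  map_mul' a b := by
    ext
    simpa using Subring.mem_center_iff.1 (τ.conj_mem_center a.2) _

@[simp] theorem coe_centerConj (z : Subring.center R) : (τ.centerConj z : R) = τ.conj z := rfl

end Ring

variable {D : Type*} [DivisionRing D] (τ : RingInvo D)

@[simp] theorem conj_inv (a : D) : τ.conj a⁻¹ = (τ.conj a)⁻¹ := by
  simp [conj_def]

/-- The subfield of symmetric central elements. -/
abbrev fixedCenter : Subfield (Subring.center D) := τ.centerConj.eqLocusField (RingHom.id _)

theorem mem_fixedCenter {z : Subring.center D} : z ∈ τ.fixedCenter ↔ τ.conj (z : D) = z := by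
  rw [RingHom.mem_eqLocusField, ← Subtype.coe_inj]; rfl

/-- The center is spanned by `1` and any `z` with `τ z ≠ z` over its symmetric elements. -/
theorem finite_fixedCenter [FiniteDimensional (Subring.center D) D] (hτ : τ.IsUnitary) :
    Module.Finite τ.fixedCenter D := by
  obtain ⟨z, hz, hne⟩ := hτ
  have hne : τ.conj z ≠ z := hne
  let Z : Subring.center D := ⟨z, hz⟩
  have h0 : Z - τ.centerConj Z ≠ 0 := fun h => hne (congrArg Subtype.val (sub_eq_zero.1 h)).symm
  have hinv : ∀ c, τ.centerConj (τ.centerConj c) = c := fun c => by ext; simp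
  have hfin : Module.Finite τ.fixedCenter (Subring.center D) := by
    refine Module.finite_def.2 (Submodule.fg_def.2 ⟨{1, Z}, Set.toFinite _, ?_⟩)
    rw [eq_top_iff]
    rintro c -
    rw [Submodule.mem_span_pair]
    let v := (c - τ.centerConj c) / (Z - τ.centerConj Z)
    have hv : τ.centerConj v = v := by
      simp only [v, map_div₀, map_sub, hinv]
      rw [← neg_sub, ← neg_sub Z, neg_div_neg_eq]
    have hu : τ.centerConj (c - v * Z) = c - v * Z := by
      rw [map_sub, map_mul, hv]
      have : v * (Z - τ.centerConj Z) = c - τ.centerConj c := div_mul_cancel₀ _ h0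
      linear_combination this
    refine ⟨⟨c - v * Z, hu⟩, ⟨v, hv⟩, ?_⟩
    simp only [Subfield.smul_def, smul_eq_mul]
    ring
  exact Module.Finite.trans (Subring.center D) D

/-- The symmetric elements, as a vector space over the symmetric central elements. -/
def symSubmodule : Submodule τ.fixedCenter D where
  carrier := {a | τ.conj a = a}
  zero_mem' := by simp
  add_mem' {a b} ha hb := by
    change τ.conj (a + b) = a + b
    rw [map_add, show τ.conj a = a from ha, show τ.conj b = b from hb]
  smul_mem' c a ha := by
    have hc := τ.mem_fixedCenter.1 c.2
    change τ.conj (c • a) = c • a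
    rw [Subfield.smul_def, Subring.smul_def, smul_eq_mul, conj_mul, show τ.conj a = a from ha, hc]
    exact Subring.mem_center_iff.1 c.1.2 _

/-- The map `s ↦ s d - τ(d) s` from symmetric to skew-symmetric elements is either injective, and
then surjective since both spaces have the same dimension, or it has a nontrivial kernel. -/
theorem exists_sym_mul_sub [FiniteDimensional (Subring.center D) D] (hτ : τ.IsUnitary)
    (d e : D) :
    (∃ s, s ≠ 0 ∧ τ.conj s = s ∧ τ.conj (s * d) = s * d) ∨
      ∃ s, τ.conj s = s ∧ τ.conj (s * d - e) = s * d - e := by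
  have hfin := τ.finite_fixedCenter hτ
  obtain ⟨z, hz, hne⟩ := hτ
  have hne : τ.conj z ≠ z := hne
  have h0 : z - τ.conj z ≠ 0 := fun h => hne (sub_eq_zero.1 h).symm
  -- dividing a skew-symmetric element by the skew-symmetric `z - τ z` makes it symmetric
  have hskew : ∀ a, τ.conj ((z - τ.conj z)⁻¹ * (a - τ.conj a)) =
      (z - τ.conj z)⁻¹ * (a - τ.conj a) := by
    intro a
    have hc : (z - τ.conj z)⁻¹ ∈ Subring.center D := by
      have := ((⟨z, hz⟩ : Subring.center D) - τ.centerConj ⟨z, hz⟩)⁻¹.2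
      rwa [Subring.center.coe_inv] at this
    simp only [conj_mul, map_sub, conj_conj, conj_inv]
    rw [← neg_sub z, ← neg_sub a, inv_neg, neg_mul_neg]
    exact Subring.mem_center_iff.1 hc _
  let B : τ.symSubmodule →ₗ[τ.fixedCenter] τ.symSubmodule :=
    { toFun := fun s => ⟨(z - τ.conj z)⁻¹ * (s * d - τ.conj (s * d)), hskew _⟩
      map_add' := fun s t => by
        ext
        simp only [Submodule.coe_add, add_mul, map_add]
        rw [add_sub_add_comm, mul_add]
      map_smul' := fun c s => by
        ext
        have hc := τ.mem_fixedCenter.1 c.2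
        have hcc := Subring.mem_center_iff.1 c.1.2
        simp only [Submodule.coe_smul, Subfield.smul_def, Subring.smul_def, smul_eq_mul, conj_mul,
          hc, RingHom.id_apply]
        rw [← mul_assoc (τ.conj d), hcc (τ.conj d * τ.conj s), mul_assoc (c.1 : D), ← mul_sub,
          ← mul_assoc, hcc, mul_assoc] }
  by_cases hB : Function.Injective B
  · right
    obtain ⟨s, hs⟩ := LinearMap.injective_iff_surjective.1 hB
      ⟨(z - τ.conj z)⁻¹ * (e - τ.conj e), hskew _⟩
    have h1 : (s : D) * d - τ.conj (s * d) = e - τ.conj e :=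
      mul_left_cancel₀ (inv_ne_zero h0) (congrArg Subtype.val hs)
    refine ⟨s, s.2, ?_⟩
    rw [map_sub]
    rw [sub_eq_sub_iff_add_eq_add] at h1 ⊢
    rw [add_comm, ← h1, add_comm]
  · left
    rw [← LinearMap.ker_eq_bot, ← ne_eq, Submodule.ne_bot_iff] at hB
    obtain ⟨s, hs, hs0⟩ := hB
    have h1 : (z - τ.conj z)⁻¹ * ((s : D) * d - τ.conj (s * d)) = 0 := congrArg Subtype.val hs
    refine ⟨s, fun h => hs0 (Subtype.ext h), s.2, ?_⟩
    exact (sub_eq_zero.1 ((mul_eq_zero.1 h1).resolve_left (inv_ne_zero h0))).symm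

/-- The quotient `D* / Σ_τ(D)` is commutative. Given `d` and `e`, there is a symmetric `s ≠ 0` such
that `s d` is symmetric or of the form `t + e` with `t` symmetric; in the latter case `d` and `e`
are congruent to the commuting elements `1 + t⁻¹ e` and `t⁻¹ e`. -/
theorem unitarySigma_mk_comm [FiniteDimensional (Subring.center D) D] (hτ : τ.IsUnitary)
    (d e : Dˣ) :
    (d : Dˣ ⧸ unitarySigma τ) * e = e * d := by
  have hsym : ∀ (s : D) (h : s ≠ 0), τ.conj s = s →
      ((Units.mk0 s h : Dˣ) : Dˣ ⧸ unitarySigma τ) = 1 := fun s h hs =>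
    (QuotientGroup.eq_one_iff _).2 (Subgroup.subset_closure hs)
  have hmul : ∀ (a b c : D) (ha : a ≠ 0) (hb : b ≠ 0) (hc : c ≠ 0), τ.conj a = a → c = a * b →
      ((Units.mk0 c hc : Dˣ) : Dˣ ⧸ unitarySigma τ) = (Units.mk0 b hb : Dˣ) := by
    rintro a b c ha hb hc hs rfl
    rw [Units.mk0_mul, QuotientGroup.mk_mul, hsym a ha hs, one_mul]
  have hd : ((Units.mk0 (d : D) d.ne_zero : Dˣ) : Dˣ ⧸ unitarySigma τ) = d := by
    rw [Units.mk0_val]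
  have he : ((Units.mk0 (e : D) e.ne_zero : Dˣ) : Dˣ ⧸ unitarySigma τ) = e := by
    rw [Units.mk0_val]
  have htriv : ∀ s : D, s ≠ 0 → τ.conj s = s → τ.conj (s * d) = s * d →
      (d : Dˣ ⧸ unitarySigma τ) * e = e * d := by
    intro s h0 hs h
    have h1 := hmul s d (s * d) h0 d.ne_zero (mul_ne_zero h0 d.ne_zero) hs rfl
    rw [hsym _ _ h, hd] at h1
    rw [← h1, one_mul, mul_one]
  rcases τ.exists_sym_mul_sub hτ d e with ⟨s, h0, hs, h⟩ | ⟨s, hs, h⟩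
  · exact htriv s h0 hs h
  by_cases h0 : s = 0
  · have : τ.conj (e : D) = e := by
      rw [h0, zero_mul, zero_sub, map_neg] at h
      exact neg_injective h
    rw [← he, hsym _ _ this, one_mul, mul_one]
  have h1 := hmul s d (s * d) h0 d.ne_zero (mul_ne_zero h0 d.ne_zero) hs rfl
  by_cases ht : (s * d : D) - e = 0
  · have h2 : Units.mk0 (s * d : D) (mul_ne_zero h0 d.ne_zero) = e :=
      Units.ext (sub_eq_zero.1 ht)
    rw [h2, hd] at h1
    rw [h1]
  have hti : τ.conj ((s * d : D) - e)⁻¹ = ((s * d : D) - e)⁻¹ := by rw [conj_inv, h]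
  set t := (s * d : D) - e with ht'
  have hu : t⁻¹ * e ≠ 0 := mul_ne_zero (inv_ne_zero ht) e.ne_zero
  have hw : t⁻¹ * (s * d) ≠ 0 := mul_ne_zero (inv_ne_zero ht) (mul_ne_zero h0 d.ne_zero)
  have h2 := hmul t⁻¹ e _ (inv_ne_zero ht) e.ne_zero hu hti rfl
  have h3 := hmul t⁻¹ (s * d) _ (inv_ne_zero ht) (mul_ne_zero h0 d.ne_zero) hw hti rfl
  have h4 : t⁻¹ * (s * d) = 1 + t⁻¹ * e := by
    rw [← inv_mul_cancel₀ ht, ← mul_add, ht', sub_add_cancel]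
  rw [← hd, ← he, ← h1, ← h2, ← h3, ← QuotientGroup.mk_mul, ← QuotientGroup.mk_mul]
  congr 1
  ext
  simp only [Units.val_mul, Units.val_mk0, h4]
  noncomm_ring

end RingInvo

/-! ### Polynomials over a division ring -/

section PolynomialArithmetic

variable {D : Type*} [DivisionRing D]

/-- The embedding `K[x] → D[x]`, where `K` is the center of `D`. -/
noncomputable def centralPoly : (Subring.center D)[X] →+* D[X] :=
  mapRingHom (Subring.center D).subtype

theorem centralPoly_C (c : Subring.center D) : centralPoly (C c) = C (c : D) := by
  simp [centralPoly]

theorem centralPoly_X : centralPoly (X : (Subring.center D)[X]) = X := by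
  simp [centralPoly]

theorem coeff_centralPoly (c : (Subring.center D)[X]) (n : ℕ) :
    (centralPoly c).coeff n = (c.coeff n : D) := by
  simp [centralPoly]

theorem centralPoly_injective : Function.Injective (centralPoly (D := D)) :=
  map_injective _ Subtype.val_injective

@[simp] theorem centralPoly_eq_zero {c : (Subring.center D)[X]} : centralPoly c = 0 ↔ c = 0 :=
  map_eq_zero_iff _ centralPoly_injective

theorem centralPoly_mul_comm (c : (Subring.center D)[X]) (f : D[X]) :
    centralPoly c * f = f * centralPoly c := by
  induction c using Polynomial.induction_on' with
  | add p q hp hq => rw [map_add, add_mul, mul_add, hp, hq]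
  | monomial n a =>
    have h : C (a : D) * f = f * C (a : D) := by
      ext k
      rw [coeff_mul_C, coeff_C_mul]
      exact (Subring.mem_center_iff.1 a.2 _).symm
    rw [← C_mul_X_pow_eq_monomial, map_mul, map_pow, centralPoly_C, centralPoly_X, mul_assoc,
      X_pow_mul, ← mul_assoc, h, mul_assoc]

/-- A polynomial commuting with the constants has coefficients in the center. -/
theorem exists_centralPoly_eq {f : D[X]} (hf : ∀ d, C d * f = f * C d) :
    ∃ c, centralPoly c = f := by
  have h : ∀ n, f.coeff n ∈ Subring.center D := fun n => Subring.mem_center_iff.2 fun d => by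
    rw [← coeff_C_mul, ← coeff_mul_C, hf]
  have hl : f ∈ Polynomial.lifts (Subring.center D).subtype :=
    (lifts_iff_coeff_lifts f).2 fun n => ⟨⟨_, h n⟩, rfl⟩
  exact (mem_lifts f).1 hl

/-- If `c` is central and `c = p q`, then also `c = q p`. -/
theorem centralPoly_eq_mul_comm {c : (Subring.center D)[X]} (hc : c ≠ 0) {p q : D[X]}
    (h : centralPoly c = p * q) : centralPoly c = q * p := by
  have hq : q ≠ 0 := by
    rintro rfl
    exact hc (centralPoly_eq_zero.1 (h.trans (mul_zero _)))
  refine mul_right_cancel₀ hq ?_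
  rw [centralPoly_mul_comm, h, mul_assoc]

/-- Division with remainder, with the divisor on the left. -/
theorem exists_eq_mul_add_degree_lt {q : D[X]} (hq : q ≠ 0) (f : D[X]) :
    ∃ a r, f = q * a + r ∧ r.degree < q.degree := by
  have hu : q.leadingCoeff * q.leadingCoeff⁻¹ = 1 :=
    mul_inv_cancel₀ (leadingCoeff_ne_zero.2 hq)
  have hm : (q * C q.leadingCoeff⁻¹).Monic := monic_mul_C_of_leadingCoeff_mul_eq_one hu
  refine ⟨C q.leadingCoeff⁻¹ * (f /ₘ (q * C q.leadingCoeff⁻¹)),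
    f %ₘ (q * C q.leadingCoeff⁻¹), ?_, (degree_modByMonic_lt _ hm).trans_le ?_⟩
  · rw [← mul_assoc, add_comm, modByMonic_add_div]
  · rw [degree_mul_C (inv_ne_zero (leadingCoeff_ne_zero.2 hq))]

/-- For `π` irreducible over the center, `π D[x]` is a prime ideal of `D[x]`. This comes from the
fact that a two-sided ideal of `D[x]` is generated by a central polynomial: its monic element
of least degree. -/
theorem centralPoly_dvd_or_dvd {π : (Subring.center D)[X]} (hπ : Irreducible π) {a b : D[X]}
    (h : ∀ y, centralPoly π ∣ a * y * b) : centralPoly π ∣ a ∨ centralPoly π ∣ b := by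
  let J : AddSubgroup D[X] :=
    { carrier := {z | ∀ y, centralPoly π ∣ z * y * b}
      zero_mem' := fun y => by simp
      add_mem' := fun hz hw y => by
        rw [add_mul, add_mul]; exact dvd_add (hz y) (hw y)
      neg_mem' := fun hz y => by
        rw [neg_mul, neg_mul]; exact (dvd_neg).2 (hz y) }
  have hr : ∀ z ∈ J, ∀ g, z * g ∈ J := fun z hz g y => by
    rw [mul_assoc z]; exact hz _
  have hl : ∀ z ∈ J, ∀ g, g * z ∈ J := fun z hz g y => by
    obtain ⟨w, hw⟩ := hz y
    exact ⟨g * w, by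
      rw [mul_assoc g, mul_assoc g, hw, ← mul_assoc, ← centralPoly_mul_comm, mul_assoc]⟩
  have hπJ : centralPoly π ∈ J := fun y => ⟨y * b, mul_assoc _ _ _⟩
  have haJ : a ∈ J := h
  have hπ0 : centralPoly π ≠ 0 := by simpa using hπ.ne_zero
  obtain ⟨c₀, ⟨hc₀J, hc₀⟩, hmin⟩ := WellFounded.has_min (measure (natDegree (R := D))).wf
    {z | z ∈ J ∧ z ≠ 0} ⟨_, hπJ, hπ0⟩
  have hmin' : ∀ z ∈ J, z.degree < c₀.degree → z = 0 := fun z hz hlt => by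
    by_contra h0
    exact hmin z ⟨hz, h0⟩ ((natDegree_lt_natDegree_iff h0).2 hlt)
  have hlc := leadingCoeff_ne_zero.2 hc₀
  set c := c₀ * C c₀.leadingCoeff⁻¹ with hc
  have hcm : c.Monic := monic_mul_C_of_leadingCoeff_mul_eq_one (mul_inv_cancel₀ hlc)
  have hcd : c.degree = c₀.degree := degree_mul_C (inv_ne_zero hlc)
  have hcJ : c ∈ J := hr _ hc₀J _
  obtain ⟨c', hc'⟩ : ∃ c', centralPoly c' = c := by
    refine exists_centralPoly_eq fun d => ?_
    by_cases hd : d = 0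
    · simp [hd]
    refine sub_eq_zero.1 (hmin' _ (J.sub_mem (hl _ hcJ _) (hr _ hcJ _)) ?_)
    have h1 : (C d * c).degree = c.degree := degree_C_mul hd
    rw [← hcd, ← h1]
    refine degree_sub_lt_left ?_ ?_ ?_
    · rw [h1, degree_mul_C hd]
    · exact mul_ne_zero (C_ne_zero.2 hd) hcm.ne_zero
    · rw [leadingCoeff_mul (C d), leadingCoeff_mul c, hcm.leadingCoeff, mul_one, one_mul]
  have hgen : ∀ z ∈ J, c ∣ z := fun z hz => by
    obtain ⟨e, r, he, hlt⟩ := exists_eq_mul_add_degree_lt hcm.ne_zero z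
    have : r = 0 := hmin' r (by
      rw [show r = z - c * e by rw [he, add_sub_cancel_left]]
      exact J.sub_mem hz (hr _ hcJ _)) (hcd ▸ hlt)
    exact ⟨e, by rw [he, this, add_zero]⟩
  obtain ⟨e, he⟩ := hgen _ hπJ
  obtain ⟨e', rfl⟩ : ∃ e', centralPoly e' = e := exists_centralPoly_eq fun d => by
    refine mul_left_cancel₀ hcm.ne_zero ?_
    rw [← mul_assoc, ← mul_assoc, ← he, ← hc', centralPoly_mul_comm c', mul_assoc, hc', ← he,
      centralPoly_mul_comm]
  rw [← hc', ← map_mul] at he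
  rcases hπ.isUnit_or_isUnit (centralPoly_injective he) with hu | hu
  · right
    obtain ⟨w, hw⟩ := hu.exists_right_inv
    have := hr _ hcJ (centralPoly w) 1
    rwa [← hc', ← map_mul, hw, map_one, one_mul, one_mul] at this
  · left
    refine dvd_trans ?_ (hgen a haJ)
    obtain ⟨w, hw⟩ := hu.exists_right_inv
    exact ⟨centralPoly w, by rw [he, ← map_mul, mul_assoc, hw, mul_one, hc']⟩

/-- A proper factor of a central polynomial is not divisible by it. -/
theorem not_centralPoly_dvd {c : (Subring.center D)[X]} (hc : c ≠ 0) {p q : D[X]}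
    (h : centralPoly c = p * q) (hp : 0 < p.natDegree) : ¬ centralPoly c ∣ q := by
  have hpq : p * q ≠ 0 := by rw [← h]; simpa using hc
  have hp0 := left_ne_zero_of_mul hpq
  have hq0 := right_ne_zero_of_mul hpq
  rintro ⟨g, hg⟩
  have hg0 : g ≠ 0 := by rintro rfl; exact hq0 (hg.trans (mul_zero _))
  have h1 := congrArg natDegree hg
  rw [h, natDegree_mul hpq hg0, natDegree_mul hp0 hq0] at h1
  omega

/-- If `p` and `q` are nonconstant and divide the same irreducible central polynomial, then there
is a nonzero homomorphism `D[x] / q D[x] → D[x] / p D[x]`; here it sends `1` to `v`. -/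
theorem exists_mul_eq_mul_of_dvd {π : (Subring.center D)[X]} (hπ : Irreducible π)
    {p p' q q' : D[X]} (hp : centralPoly π = p * p') (hq : centralPoly π = q * q')
    (hpd : 0 < p.natDegree) (hqd : 0 < q.natDegree) :
    ∃ u v, v ≠ 0 ∧ v * q = p * u ∧ v.degree < p.degree := by
  obtain ⟨y, hy⟩ : ∃ y, ¬ centralPoly π ∣ p' * y * q' := by
    by_contra! h
    rcases centralPoly_dvd_or_dvd hπ h with h | h
    · exact not_centralPoly_dvd hπ.ne_zero hp hpd h
    · exact not_centralPoly_dvd hπ.ne_zero hq hqd h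
  have hp0 : p ≠ 0 := ne_zero_of_natDegree_gt hpd
  obtain ⟨a, v, hv, hlt⟩ := exists_eq_mul_add_degree_lt hp0 (y * q')
  refine ⟨p' * y - a * q, v, ?_, ?_, hlt⟩
  · rintro rfl
    apply hy
    rw [mul_assoc, hv, add_zero, ← mul_assoc, ← centralPoly_eq_mul_comm hπ.ne_zero hp]
    exact dvd_mul_right _ _
  · have hv' : v = y * q' - p * a := by rw [hv, add_sub_cancel_left]
    rw [hv', sub_mul, mul_assoc, ← centralPoly_eq_mul_comm hπ.ne_zero hq, ← centralPoly_mul_comm,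
      hp, mul_sub, mul_assoc, mul_assoc]

end PolynomialArithmetic

namespace RingInvo
variable {D : Type*} [DivisionRing D] (τ : RingInvo D)

/-- The involution `∑ dᵢ xⁱ ↦ ∑ τ(dᵢ) xⁱ` of `D[x]`. -/
noncomputable def poly : RingInvo D[X] :=
  RingInvo.mk' (RatDiv.polyHom τ) (RatDiv.polyHom_polyHom τ)

theorem poly_conj_C (d : D) : τ.poly.conj (C d) = C (τ.conj d) :=
  congrArg MulOpposite.unop (RatDiv.polyHom_C τ d)

theorem poly_conj_X : τ.poly.conj X = X :=
  congrArg MulOpposite.unop (RatDiv.polyHom_X τ)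

theorem poly_conj_X_pow (n : ℕ) : τ.poly.conj (X ^ n) = X ^ n := by
  induction n with
  | zero => simp
  | succ n ih => rw [pow_succ, conj_mul, ih, poly_conj_X, X_mul]

theorem coeff_poly_conj (f : D[X]) (n : ℕ) : (τ.poly.conj f).coeff n = τ.conj (f.coeff n) := by
  induction f using Polynomial.induction_on' with
  | add p q hp hq => simp [hp, hq]
  | monomial k a =>
    rw [← C_mul_X_pow_eq_monomial, conj_mul, poly_conj_C, poly_conj_X_pow, X_pow_mul,
      coeff_C_mul_X_pow, coeff_C_mul_X_pow]
    split_ifs <;> simp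

theorem degree_poly_conj_le (f : D[X]) : (τ.poly.conj f).degree ≤ f.degree := by
  rw [degree_le_iff_coeff_zero]
  intro n hn
  rw [coeff_poly_conj, coeff_eq_zero_of_degree_lt hn, map_zero]

@[simp] theorem degree_poly_conj (f : D[X]) : (τ.poly.conj f).degree = f.degree := by
  refine le_antisymm (τ.degree_poly_conj_le f) ?_
  conv_lhs => rw [← τ.poly.conj_conj f]
  exact τ.degree_poly_conj_le _

@[simp] theorem natDegree_poly_conj (f : D[X]) : (τ.poly.conj f).natDegree = f.natDegree := by
  rw [natDegree, degree_poly_conj, natDegree]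

theorem leadingCoeff_poly_conj (f : D[X]) :
    (τ.poly.conj f).leadingCoeff = τ.conj f.leadingCoeff := by
  rw [leadingCoeff, coeff_poly_conj, natDegree_poly_conj, leadingCoeff]

@[simp] theorem poly_conj_eq_zero {f : D[X]} : τ.poly.conj f = 0 ↔ f = 0 := by
  rw [← degree_eq_bot, degree_poly_conj, degree_eq_bot]

theorem poly_conj_centralPoly (c : (Subring.center D)[X]) :
    τ.poly.conj (centralPoly c) = centralPoly (c.map τ.centerConj) := by
  ext n
  rw [coeff_poly_conj, coeff_centralPoly, coeff_centralPoly, coeff_map, coe_centerConj]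

theorem map_centerConj_map_centerConj (c : (Subring.center D)[X]) :
    (c.map τ.centerConj).map τ.centerConj = c := by
  apply centralPoly_injective
  rw [← poly_conj_centralPoly, ← poly_conj_centralPoly, conj_conj]

theorem irreducible_map_centerConj {π : (Subring.center D)[X]} (hπ : Irreducible π) :
    Irreducible (π.map τ.centerConj) := by
  let e : (Subring.center D)[X] ≃+* (Subring.center D)[X] :=
    RingEquiv.ofRingHom (mapRingHom τ.centerConj) (mapRingHom τ.centerConj)
      (RingHom.ext fun c => τ.map_centerConj_map_centerConj c)
      (RingHom.ext fun c => τ.map_centerConj_map_centerConj c)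
  have h := (MulEquiv.irreducible_iff e).2 hπ
  exact h

/-- If `π = p p'` is a symmetric irreducible central polynomial, then some multiple of `p'` of
degree less than `π` is symmetric. It is the remainder modulo `π` of an element `τ(p') y p'`,
where `y` is symmetric and this element is not divisible by `π`. -/
theorem exists_symmetric_mul (hτ : τ.IsUnitary) {π : (Subring.center D)[X]} (hπ : Irreducible π)
    (hs : π.map τ.centerConj = π) {p p' : D[X]} (hp : centralPoly π = p * p')
    (hpd : 0 < p.natDegree) :
    ∃ q, q * p' ≠ 0 ∧ τ.poly.conj (q * p') = q * p' ∧ q.natDegree < p.natDegree := by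
  obtain ⟨z, hz, hne⟩ := hτ
  have hne : τ.conj z ≠ z := hne
  have hπs : τ.poly.conj (centralPoly π) = centralPoly π := by rw [poly_conj_centralPoly, hs]
  have hπ0 : centralPoly π ≠ 0 := by simpa using hπ.ne_zero
  have hp'0 : p' ≠ 0 := by rintro rfl; exact hπ0 (hp.trans (mul_zero _))
  have hp0 : p ≠ 0 := by rintro rfl; exact hπ0 (hp.trans (zero_mul _))
  have hpp := centralPoly_eq_mul_comm hπ.ne_zero hp
  have hnd := not_centralPoly_dvd hπ.ne_zero hp hpd
  have hnd' : ¬ centralPoly π ∣ τ.poly.conj p' := by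
    refine not_centralPoly_dvd hπ.ne_zero (p := τ.poly.conj p) ?_ (by simpa using hpd)
    rw [← conj_mul, ← hpp, hπs]
  obtain ⟨y, hy⟩ : ∃ y, ¬ centralPoly π ∣ τ.poly.conj p' * y * p' := by
    by_contra! h
    rcases centralPoly_dvd_or_dvd hπ h with h | h
    · exact hnd' h
    · exact hnd h
  -- one of the traces of `y` and of `z y` works, because `z - τ z` is invertible
  obtain ⟨y, hys, hy⟩ : ∃ y, τ.poly.conj y = y ∧ ¬ centralPoly π ∣ τ.poly.conj p' * y * p' := by
    by_contra! h
    have h1 := h (y + τ.poly.conj y) (by simp [add_comm])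
    have h2 := h (C z * y + τ.poly.conj (C z * y)) (by simp [add_comm])
    apply hy
    let Z : (Subring.center D)[X] := C ⟨z, hz⟩
    have hZ : C z = centralPoly Z := (centralPoly_C (⟨z, hz⟩ : Subring.center D)).symm
    have hZc : ∀ f : D[X], C z * f = f * C z := fun f => by rw [hZ, centralPoly_mul_comm]
    have hZc' : ∀ f : D[X], C (τ.conj z) * f = f * C (τ.conj z) := fun f => by
      rw [← poly_conj_C, hZ, poly_conj_centralPoly, centralPoly_mul_comm]
    set P := τ.poly.conj p' with hP
    set Y := τ.poly.conj y with hY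
    have h3 : centralPoly π ∣ P * y * p' * C (z - τ.conj z) := by
      have : P * y * p' * C (z - τ.conj z) =
          P * (C z * y + τ.poly.conj (C z * y)) * p' - P * (y + Y) * p' * C (τ.conj z) := by
        rw [conj_mul, poly_conj_C, ← hY, hZc, C_sub]
        simp only [mul_add, add_mul, mul_sub, mul_assoc, hZc p', hZc' p']
        abel
      rw [this]
      exact dvd_sub h2 (h1.mul_right _)
    have h4 := h3.mul_right (C (z - τ.conj z)⁻¹)
    rwa [mul_assoc, ← C_mul, mul_inv_cancel₀ (sub_ne_zero.2 hne.symm), C_1, mul_one] at h4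
  obtain ⟨g, s, hgs, hlt⟩ := exists_eq_mul_add_degree_lt hπ0 (τ.poly.conj p' * y * p')
  have hs0 : s ≠ 0 := by
    rintro rfl
    exact hy ⟨g, by rw [hgs, add_zero]⟩
  have hsq : s = (τ.poly.conj p' * y - g * p) * p' := by
    rw [sub_mul, hgs, mul_assoc g, ← hp, centralPoly_mul_comm, add_sub_cancel_left]
  have hss : τ.poly.conj s = s := by
    have h1 : τ.poly.conj (τ.poly.conj p' * y * p') = τ.poly.conj p' * y * p' := by
      simp [hys, mul_assoc]
    rw [hgs, map_add, conj_mul, hπs, ← centralPoly_mul_comm] at h1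
    by_contra hne'
    have h2 : centralPoly π * (g - τ.poly.conj g) = τ.poly.conj s - s := by
      rw [mul_sub, sub_eq_sub_iff_add_eq_add, ← h1, add_comm]
    have h3 : (τ.poly.conj s - s).degree < (centralPoly π).degree :=
      (degree_sub_le _ _).trans_lt (by simpa using hlt)
    have h4 : g - τ.poly.conj g ≠ 0 := by
      intro h0
      rw [h0, mul_zero] at h2
      exact hne' (sub_eq_zero.1 h2.symm)
    rw [← h2, degree_mul] at h3
    exact absurd (le_add_of_nonneg_right (zero_le_degree_iff.2 h4)) (not_le.2 h3)
  refine ⟨_, hsq ▸ hs0, hsq ▸ hss, ?_⟩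
  have hq0 : τ.poly.conj p' * y - g * p ≠ 0 := fun h => hs0 (by rw [hsq, h, zero_mul])
  rw [hsq, hp, degree_mul, degree_mul, degree_eq_natDegree hq0, degree_eq_natDegree hp'0,
    degree_eq_natDegree hp0] at hlt
  norm_cast at hlt
  omega

end RingInvo

/-! ### The norm of a polynomial and reduction of degrees -/

section PolyNorm

variable {D : Type*} [DivisionRing D] {ι : Type*} [Fintype ι] [DecidableEq ι]
  (b : Module.Basis ι (Subring.center D) D)

/-- The left regular representation of `D[x]` over `K[x]`, where `K` is the center of `D`, with
respect to a basis of `D` over `K`. -/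
noncomputable def regPoly : D[X] →+* Matrix ι ι (Subring.center D)[X] :=
  (matPolyEquiv (R := Subring.center D) (n := ι)).symm.toRingEquiv.toRingHom.comp
    (mapRingHom (Algebra.leftMulMatrix b).toRingHom)

theorem coeff_regPoly (f : D[X]) (i j : ι) (n : ℕ) :
    (regPoly b f i j).coeff n = Algebra.leftMulMatrix b (f.coeff n) i j := by
  rw [← matPolyEquiv_coeff_apply]
  have : matPolyEquiv (regPoly b f) = f.map (Algebra.leftMulMatrix b).toRingHom :=
    AlgEquiv.apply_symm_apply _ _
  rw [this, coeff_map]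
  rfl

theorem regPoly_centralPoly (c : (Subring.center D)[X]) :
    regPoly b (centralPoly c) = Matrix.scalar ι c := by
  ext i j n
  rw [coeff_regPoly, coeff_centralPoly]
  have h : Algebra.leftMulMatrix b ((c.coeff n : Subring.center D) : D) =
      algebraMap _ _ (c.coeff n) := (Algebra.leftMulMatrix b).commutes (c.coeff n)
  rw [h, Matrix.algebraMap_matrix_apply, Matrix.scalar_apply, Matrix.diagonal_apply]
  split_ifs <;> simp

/-- The norm from `D[x]` to `K[x]`, where `K` is the center of `D`: the determinant of left
multiplication. -/
noncomputable def polyNorm : D[X] →* (Subring.center D)[X] :=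
  Matrix.detMonoidHom.comp (regPoly b : D[X] →* Matrix ι ι (Subring.center D)[X])

theorem polyNorm_apply (f : D[X]) : polyNorm b f = (regPoly b f).det := rfl

theorem polyNorm_centralPoly (c : (Subring.center D)[X]) :
    polyNorm b (centralPoly c) = c ^ Fintype.card ι := by
  rw [polyNorm_apply, regPoly_centralPoly, Matrix.scalar_apply, Matrix.det_diagonal,
    Finset.prod_const, Finset.card_univ]

/-- The leading coefficient of the norm of `f` is the norm of the leading coefficient of `f`, so
that it does not vanish. -/
theorem natDegree_polyNorm_pos {f : D[X]} (hf : 0 < f.natDegree) :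
    0 < (polyNorm b f).natDegree := by
  have hne : Nonempty ι := b.index_nonempty
  have hf0 : f ≠ 0 := ne_zero_of_natDegree_gt hf
  have hco : (polyNorm b f).coeff (Fintype.card ι * f.natDegree) =
      (Algebra.leftMulMatrix b f.leadingCoeff).det := by
    rw [polyNorm_apply, Matrix.det_apply, Matrix.det_apply, finsetSum_coeff]
    refine Finset.sum_congr rfl fun σ _ => ?_
    rw [coeff_smul, ← Finset.card_univ, coeff_prod_of_natDegree_le]
    · simp only [coeff_regPoly]
      rfl
    · intro i _
      rw [natDegree_le_iff_coeff_eq_zero]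
      intro n hn
      rw [coeff_regPoly, coeff_eq_zero_of_natDegree_lt hn, map_zero]
      rfl
  have hu : IsUnit (Algebra.leftMulMatrix b f.leadingCoeff).det :=
    (Matrix.isUnit_iff_isUnit_det _).1
      ((isUnit_iff_ne_zero.2 (leadingCoeff_ne_zero.2 hf0)).map (Algebra.leftMulMatrix b))
  rw [← hco] at hu
  exact (Nat.mul_pos Fintype.card_pos hf).trans_le (le_natDegree_of_ne_zero hu.ne_zero)

/-- If an irreducible `π` divides the norm of `f`, then `f` is not invertible modulo `π`, and
a generator of the right ideal `f D[x] + π D[x]` is a nontrivial left factor. -/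
theorem exists_eq_mul_of_dvd_polyNorm {π : (Subring.center D)[X]} (hπ : Irreducible π) {f : D[X]}
    (h : π ∣ polyNorm b f) :
    ∃ p f' p', f = p * f' ∧ centralPoly π = p * p' ∧ 0 < p.natDegree := by
  have hπ0 : centralPoly π ≠ 0 := by simpa using hπ.ne_zero
  obtain ⟨p, ⟨⟨g, k, hp⟩, hp0⟩, hmin⟩ := WellFounded.has_min (measure (natDegree (R := D))).wf
    {z | (∃ g k, z = f * g + centralPoly π * k) ∧ z ≠ 0} ⟨_, ⟨0, 1, by simp⟩, hπ0⟩
  have hdvd : ∀ z g' k', z = f * g' + centralPoly π * k' → p ∣ z := fun z g' k' hz => by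
    obtain ⟨e, r, he, hlt⟩ := exists_eq_mul_add_degree_lt hp0 z
    have hr : r = 0 := by
      by_contra hr
      refine hmin r ⟨⟨g' - g * e, k' - k * e, ?_⟩, hr⟩ ((natDegree_lt_natDegree_iff hr).2 hlt)
      rw [show r = z - p * e by rw [he, add_sub_cancel_left], hz, hp]
      noncomm_ring
    exact ⟨e, by rw [he, hr, add_zero]⟩
  obtain ⟨f', hf'⟩ := hdvd f 1 0 (by simp)
  obtain ⟨p', hp'⟩ := hdvd (centralPoly π) 0 1 (by simp)
  refine ⟨p, f', p', hf', hp', Nat.pos_of_ne_zero fun hd => hπ.not_isUnit ?_⟩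
  have hpc := eq_C_of_natDegree_eq_zero hd
  have hc0 : p.coeff 0 ≠ 0 := fun h0 => hp0 (by rw [hpc, h0, C_0])
  have h1 : f * (g * C (p.coeff 0)⁻¹) = 1 + centralPoly π * (-(k * C (p.coeff 0)⁻¹)) := by
    rw [mul_neg, ← sub_eq_add_neg, eq_sub_iff_add_eq, ← mul_assoc, ← mul_assoc, ← add_mul, ← hp]
    nth_rw 1 [hpc]
    rw [← C_mul, mul_inv_cancel₀ hc0, C_1]
  -- modulo `π` the right-hand side has determinant `1` and the left-hand side determinant `0`
  let φ := Ideal.Quotient.mk (Ideal.span {π})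
  have hφ : φ π = 0 := Ideal.Quotient.eq_zero_iff_mem.2 (Ideal.mem_span_singleton_self π)
  have h2 := congrArg φ (congrArg (polyNorm b) h1)
  obtain ⟨w, hw⟩ := h
  rw [map_mul, hw, mul_assoc, map_mul, hφ, zero_mul, polyNorm_apply, RingHom.map_det, map_add,
    map_mul, regPoly_centralPoly, map_one, map_add, map_one, map_mul] at h2
  have h3 : φ.mapMatrix (Matrix.scalar ι π) = 0 := by
    ext i j
    rw [RingHom.mapMatrix_apply, Matrix.map_apply, Matrix.scalar_apply, Matrix.diagonal_apply]
    split_ifs <;> simp [hφ]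
  rw [h3, zero_mul, add_zero, Matrix.det_one] at h2
  have h4 : φ 1 = 0 := by rw [map_one, h2]
  rw [Ideal.Quotient.eq_zero_iff_mem, Ideal.mem_span_singleton] at h4
  exact isUnit_of_dvd_one h4

/-- Let `θ` be a multiplicative map on `D[x]` to a commutative group that is trivial on symmetric
polynomials. Then a nonconstant polynomial with symmetric norm can be replaced by one of
smaller degree. With `π` an irreducible factor of the norm, either `π` is symmetric, and a factor
`p` of `f` dividing `π` is replaced using a symmetric multiple of `π / p`, or `τ(π)` is
a further factor of the norm, and factors `p` and `r` dividing `π` and `τ(π)` are replaced using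
a relation `v p = τ(r) u`. -/
theorem exists_natDegree_lt_of_symmetric_polyNorm {τ : RingInvo D} (hτ : τ.IsUnitary)
    {G : Type*} [CommGroupWithZero G] (θ : D[X] →*₀ G) (hθ : ∀ f, f ≠ 0 → θ f ≠ 0)
    (hsym : ∀ s, s ≠ 0 → τ.poly.conj s = s → θ s = 1) {f : D[X]} (hfd : 0 < f.natDegree)
    (hf : (polyNorm b f).map τ.centerConj = polyNorm b f) :
    ∃ g, g ≠ 0 ∧ g.natDegree < f.natDegree ∧ θ g = θ f := by
  have hf0 : f ≠ 0 := ne_zero_of_natDegree_gt hfd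
  have hconj : ∀ a, a ≠ 0 → θ a * θ (τ.poly.conj a) = 1 := fun a ha => by
    rw [← map_mul]
    exact hsym _ (mul_ne_zero ha (by simpa using ha)) (by simp)
  obtain ⟨π, hπm, hπ, hπf⟩ := exists_monic_irreducible_factor (polyNorm b f)
    (fun hu => (natDegree_polyNorm_pos b hfd).ne' (natDegree_eq_zero_of_isUnit hu))
  have hπ0 : centralPoly π ≠ 0 := by simpa using hπ.ne_zero
  obtain ⟨p, f₁, p', hpf, hp, hpd⟩ := exists_eq_mul_of_dvd_polyNorm b hπ hπf
  have hp0 : p ≠ 0 := ne_zero_of_natDegree_gt hpd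
  have hf₁0 : f₁ ≠ 0 := by rintro rfl; exact hf0 (hpf.trans (mul_zero _))
  have hp'0 : p' ≠ 0 := by rintro rfl; exact hπ0 (hp.trans (mul_zero _))
  by_cases hπτ : π.map τ.centerConj = π
  · obtain ⟨q, hq0, hqs, hqd⟩ := τ.exists_symmetric_mul hτ hπ hπτ hp hpd
    have h1 := hsym _ hq0 hqs
    have h2 := hsym _ hπ0 (by rw [RingInvo.poly_conj_centralPoly, hπτ])
    rw [hp] at h2
    rw [map_mul] at h1 h2
    have hqp : θ q = θ p := mul_right_cancel₀ (hθ p' hp'0) (h1.trans h2.symm)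
    refine ⟨q * f₁, mul_ne_zero (left_ne_zero_of_mul hq0) hf₁0, ?_, ?_⟩
    · rw [hpf, natDegree_mul (left_ne_zero_of_mul hq0) hf₁0, natDegree_mul hp0 hf₁0]
      omega
    · rw [hpf, map_mul, map_mul, hqp]
  · have hτπ := τ.irreducible_map_centerConj hπ
    have hdvd : π.map τ.centerConj ∣ polyNorm b p * polyNorm b f₁ := by
      rw [← map_mul, ← hpf, ← hf]
      exact Polynomial.map_dvd _ hπf
    have hndvd : ¬ π.map τ.centerConj ∣ polyNorm b p := by
      intro h
      have h1 : π.map τ.centerConj ∣ π ^ Fintype.card ι := by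
        rw [← polyNorm_centralPoly b, hp, map_mul]
        exact h.mul_right _
      have h2 := (hτπ.dvd_irreducible_iff_associated hπ).1 (hτπ.prime.dvd_of_dvd_pow h1)
      exact hπτ (eq_of_monic_of_associated (hπm.map _) hπm h2)
    obtain ⟨r, f₂, r', hrf, hr, hrd⟩ :=
      exists_eq_mul_of_dvd_polyNorm b hτπ ((hτπ.prime.dvd_or_dvd hdvd).resolve_left hndvd)
    have hr0 : r ≠ 0 := ne_zero_of_natDegree_gt hrd
    have hf₂0 : f₂ ≠ 0 := by rintro rfl; exact hf₁0 (hrf.trans (mul_zero _))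
    have hr' : centralPoly π = τ.poly.conj r * τ.poly.conj r' := by
      have := centralPoly_eq_mul_comm hτπ.ne_zero hr
      rw [← RingInvo.conj_mul, ← this, RingInvo.poly_conj_centralPoly,
        RingInvo.map_centerConj_map_centerConj]
    obtain ⟨u, v, hv0, huv, hvd⟩ := exists_mul_eq_mul_of_dvd hπ hr' hp (by simpa using hrd) hpd
    have hu0 : u ≠ 0 := by
      rintro rfl
      exact mul_ne_zero hv0 hp0 (huv.trans (mul_zero _))
    have hcr0 : τ.poly.conj r ≠ 0 := by simpa using hr0
    have hcv0 : τ.poly.conj v ≠ 0 := by simpa using hv0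
    have hvd' := (natDegree_lt_natDegree_iff hv0).2 hvd
    rw [RingInvo.natDegree_poly_conj] at hvd'
    have hdeg := congrArg natDegree huv
    rw [natDegree_mul hv0 hp0, natDegree_mul hcr0 hu0, RingInvo.natDegree_poly_conj] at hdeg
    have hθuv : θ (u * τ.poly.conj v) = θ (p * r) := by
      have h1 := congrArg θ huv
      have h2 := hconj v hv0
      have h3 := hconj r hr0
      rw [map_mul, map_mul] at h1 ⊢
      calc θ u * θ (τ.poly.conj v) = θ r * (θ (τ.poly.conj r) * θ u) * θ (τ.poly.conj v) := by
            rw [← mul_assoc (θ r), h3, one_mul]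
        _ = (θ v * θ (τ.poly.conj v)) * (θ p * θ r) := by
            rw [← h1, mul_comm (θ r), mul_assoc (θ v), mul_right_comm]
        _ = θ p * θ r := by rw [h2, one_mul]
    refine ⟨u * τ.poly.conj v * f₂, mul_ne_zero (mul_ne_zero hu0 hcv0) hf₂0, ?_, ?_⟩
    · rw [hpf, hrf, natDegree_mul (mul_ne_zero hu0 hcv0) hf₂0, natDegree_mul hu0 hcv0,
        natDegree_mul hp0 (mul_ne_zero hr0 hf₂0), natDegree_mul hr0 hf₂0,
        RingInvo.natDegree_poly_conj]
      omega
    · rw [hpf, hrf, ← mul_assoc, map_mul, hθuv, ← map_mul]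

end PolyNorm

/-! ### The reduced norm and minimal polynomials -/

section ReducedCharpoly

theorem charpoly_pi_const {R M : Type*} [CommRing R] [AddCommGroup M] [Module R M]
    [Module.Free R M] [Module.Finite R M] (f : M →ₗ[R] M) (n : ℕ) :
    (LinearMap.pi fun i : Fin n => f ∘ₗ LinearMap.proj i).charpoly = f.charpoly ^ n := by
  nontriviality R
  induction n with
  | zero =>
    rw [pow_zero]
    refine (LinearMap.charpoly_monic _).natDegree_eq_zero.1 ?_
    rw [LinearMap.charpoly_natDegree, Module.finrank_zero_of_subsingleton]
  | succ n ih =>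
    rw [pow_succ', ← ih, ← LinearMap.charpoly_prodMap,
      ← LinearEquiv.charpoly_conj (Fin.consLinearEquiv R fun _ : Fin (n + 1) => M)]
    congr 1
    refine LinearMap.ext fun x => funext fun i => ?_
    refine Fin.cases ?_ (fun j => ?_) i <;> simp [LinearEquiv.conj_apply, Fin.tail]

section Field
variable {K D : Type*} [Field K] [DivisionRing D] [Algebra K D] [FiniteDimensional K D]

/-- Left multiplication by `a` turns a division algebra into a vector space over the field
`K[x] / (m)`, where `m` is the minimal polynomial of `a`. -/
theorem exists_equiv_adjoinRoot (a : D) :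
    ∃ (t : ℕ) (e : D ≃ₗ[K] (Fin t → AdjoinRoot (minpoly K a))),
      ∀ (p : K[X]) x i, e (aeval a p * x) i = AdjoinRoot.mk _ p * e x i := by
  have hirr : Fact (Irreducible (minpoly K a)) :=
    ⟨minpoly.irreducible (Algebra.IsIntegral.isIntegral a)⟩
  let j : AdjoinRoot (minpoly K a) →+* D :=
    Ideal.Quotient.lift _ (aeval a : K[X] →ₐ[K] D).toRingHom fun p hp => by
      obtain ⟨q, rfl⟩ := Ideal.mem_span_singleton.1 hp
      simp
  have hj : ∀ p, j (AdjoinRoot.mk _ p) = aeval a p := fun p => rfl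
  let _ : Module (AdjoinRoot (minpoly K a)) D := Module.compHom D j
  have hsmul : ∀ (l : AdjoinRoot (minpoly K a)) (x : D), l • x = j l * x := fun _ _ => rfl
  have htower : IsScalarTower K (AdjoinRoot (minpoly K a)) D := ⟨fun k l x => by
    obtain ⟨p, rfl⟩ := AdjoinRoot.mk_surjective l
    rw [AdjoinRoot.smul_mk, hsmul, hsmul, hj, hj, map_smul, smul_mul_assoc]⟩
  have hfin : Module.Finite (AdjoinRoot (minpoly K a)) D := Module.Finite.right K _ D
  let b := Module.finBasis (AdjoinRoot (minpoly K a)) D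
  refine ⟨_, b.equivFun.restrictScalars K, fun p x i => ?_⟩
  have := congrFun (map_smul b.equivFun (AdjoinRoot.mk _ p) x) i
  rwa [hsmul, hj] at this

theorem charpoly_lmul_eq_minpoly_pow {a : D} {t : ℕ}
    (e : D ≃ₗ[K] (Fin t → AdjoinRoot (minpoly K a)))
    (he : ∀ (p : K[X]) x i, e (aeval a p * x) i = AdjoinRoot.mk _ p * e x i) :
    (Algebra.lmul K D a).charpoly = minpoly K a ^ t := by
  have hm0 : minpoly K a ≠ 0 := minpoly.ne_zero (Algebra.IsIntegral.isIntegral a)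
  have hirr : Fact (Irreducible (minpoly K a)) :=
    ⟨minpoly.irreducible (Algebra.IsIntegral.isIntegral a)⟩
  let pb := AdjoinRoot.powerBasis hm0
  have hfin : Module.Finite K (AdjoinRoot (minpoly K a)) := pb.finite
  have h1 : (Algebra.lmul K (AdjoinRoot (minpoly K a)) (AdjoinRoot.root _)).charpoly =
      minpoly K a := by
    rw [← LinearMap.charpoly_toMatrix _ pb.basis]
    refine (charpoly_leftMulMatrix pb).trans ?_
    rw [AdjoinRoot.powerBasis_gen, AdjoinRoot.minpoly_root hm0,
      (minpoly.monic (Algebra.IsIntegral.isIntegral a)).leadingCoeff, inv_one, C_1, mul_one]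
  rw [← h1, ← charpoly_pi_const, ← LinearEquiv.charpoly_conj e]
  congr 1
  refine LinearMap.ext fun x => funext fun i => ?_
  have := he X (e.symm x) i
  rw [aeval_X, e.apply_symm_apply, AdjoinRoot.mk_X] at this
  simpa [LinearEquiv.conj_apply] using this

/-- If `α` is a root of the minimal polynomial of `a`, then modulo the range of `a - α` the space
`L ⊗ D` has a basis in bijection with a basis of `D` over `K[x] / (m)`. -/
theorem finrank_ker_baseChange_lmul_sub {a : D} {t : ℕ}
    (e : D ≃ₗ[K] (Fin t → AdjoinRoot (minpoly K a)))
    (he : ∀ (p : K[X]) x i, e (aeval a p * x) i = AdjoinRoot.mk _ p * e x i)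
    {L : Type*} [Field L] [Algebra K L] {α : L}
    (hα : aeval α (minpoly K a) = 0) :
    Module.finrank L (LinearMap.ker ((Algebra.lmul K D a).baseChange L -
      algebraMap L (Module.End L (L ⊗[K] D)) α)) = t := by
  let σ : AdjoinRoot (minpoly K a) →ₐ[K] L :=
    AdjoinRoot.liftAlgHom _ (Algebra.ofId K L) α hα
  have hσ : ∀ p, σ (AdjoinRoot.mk _ p) = aeval α p := fun p =>
    AdjoinRoot.lift_mk (i := (Algebra.ofId K L).toRingHom) hα p
  set T' := (Algebra.lmul K D a).baseChange L with hT'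
  set T := T' - algebraMap L (Module.End L (L ⊗[K] D)) α with hT
  let ψ : L ⊗[K] D →ₗ[L] (Fin t → L) := LinearMap.liftBaseChange L
    ((LinearMap.pi fun i => σ.toLinearMap ∘ₗ LinearMap.proj i) ∘ₗ e.toLinearMap)
  have hψ : ∀ l x i, ψ (l ⊗ₜ x) i = l * σ (e x i) := fun l x i => by simp [ψ]
  have haev : ∀ (p : K[X]) l x, aeval T' (p.map (algebraMap K L)) (l ⊗ₜ x) =
      l ⊗ₜ (aeval a p * x) := by
    intro p
    have h1 : aeval T' (p.map (algebraMap K L)) = (Algebra.lmul K D (aeval a p)).baseChange L := by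
      rw [aeval_map_algebraMap]
      have : (Algebra.lmul K D (aeval a p)).baseChange L =
        ((Module.End.baseChangeHom K L D).comp (Algebra.lmul K D)) (aeval a p) := rfl
      rw [this, ← aeval_algHom_apply]
      rfl
    intro l x
    rw [h1]
    rfl
  -- every tensor is congruent to a combination of the `1 ⊗ eᵢ` modulo the range of `T`
  have hcong : ∀ y, y - ∑ i, ψ y i ⊗ₜ e.symm (Pi.single i 1) ∈ LinearMap.range T := by
    intro y
    induction y with
    | zero => simp
    | add y z hy hz =>
      have := add_mem hy hz
      rw [← add_sub_add_comm, ← Finset.sum_add_distrib] at this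
      simpa only [map_add, Pi.add_apply, TensorProduct.add_tmul] using this
    | tmul l x =>
      have hx : x = ∑ i, e.symm (Pi.single i (e x i)) := by
        rw [← map_sum, Finset.univ_sum_single, e.symm_apply_apply]
      have h1 : l ⊗ₜ[K] x = ∑ i, l ⊗ₜ[K] e.symm (Pi.single i (e x i)) := by
        conv_lhs => rw [hx]
        rw [TensorProduct.tmul_sum]
      rw [h1, ← Finset.sum_sub_distrib]
      refine Submodule.sum_mem _ fun i _ => ?_
      rw [← h1, hψ]
      obtain ⟨p, hp⟩ := AdjoinRoot.mk_surjective (e x i)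
      have h2 : e.symm (Pi.single i (e x i)) = aeval a p * e.symm (Pi.single i 1) := by
        rw [LinearEquiv.symm_apply_eq]
        ext k
        rw [he, e.apply_symm_apply, hp]
        by_cases hk : k = i
        · subst hk; simp
        · simp [hk]
      obtain ⟨q, hq⟩ := X_sub_C_dvd_sub_C_eval (p := p.map (algebraMap K L)) (a := α)
      have h3 := congrArg (fun r => aeval T' r (l ⊗ₜ[K] e.symm (Pi.single i 1))) hq
      simp only [map_sub, LinearMap.sub_apply, haev, map_mul, aeval_C, aeval_X] at h3
      rw [h2, ← hp, hσ]
      refine ⟨aeval T' q (l ⊗ₜ e.symm (Pi.single i 1)), h3.symm.trans ?_⟩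
      congr 1
      rw [eval_map_algebraMap, Module.algebraMap_end_apply, TensorProduct.smul_tmul', smul_eq_mul,
        mul_comm]
  have hker : LinearMap.ker ψ = LinearMap.range T := by
    apply le_antisymm
    · intro y hy
      have h1 := hcong y
      rw [LinearMap.mem_ker.1 hy] at h1
      simpa using h1
    · rintro _ ⟨y, rfl⟩
      rw [LinearMap.mem_ker]
      induction y with
      | zero => simp
      | add y z hy hz => rw [map_add, map_add, hy, hz, add_zero]
      | tmul l x =>
        ext i
        have h1 := he X x i
        rw [aeval_X, AdjoinRoot.mk_X] at h1
        have h2 : σ (AdjoinRoot.root _) = α := by rw [← AdjoinRoot.mk_X, hσ, aeval_X]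
        have h3 : T (l ⊗ₜ x) = l ⊗ₜ (a * x) - (α * l) ⊗ₜ x := rfl
        rw [h3, map_sub, Pi.sub_apply, hψ, hψ, h1, map_mul, h2, Pi.zero_apply]
        ring
  have hsurj : LinearMap.range ψ = ⊤ := by
    rw [LinearMap.range_eq_top]
    intro y
    refine ⟨∑ i, y i ⊗ₜ e.symm (Pi.single i 1), ?_⟩
    ext k
    rw [map_sum, Finset.sum_apply, Finset.sum_eq_single k]
    · rw [hψ, e.apply_symm_apply]; simp
    · intro i _ hik
      rw [hψ, e.apply_symm_apply, Pi.single_eq_of_ne hik.symm]; simp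
    · simp
  have h1 := ψ.finrank_range_add_finrank_ker
  have h2 := T.finrank_range_add_finrank_ker
  rw [hker, hsurj, finrank_top, Module.finrank_fin_fun] at h1
  omega

end Field

/-- The kernel of left multiplication by a matrix `B` on square matrices consists of the matrices
with columns in the kernel of `B`. -/
theorem finrank_ker_lmul_matrix {L : Type*} [Field L] {n : ℕ} (B : Matrix (Fin n) (Fin n) L) :
    Module.finrank L (LinearMap.ker (Algebra.lmul L _ B)) =
      n * Module.finrank L (LinearMap.ker B.mulVecLin) := by
  let E : LinearMap.ker (Algebra.lmul L _ B) ≃ₗ[L] (Fin n → LinearMap.ker B.mulVecLin) :=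
    { toFun := fun M j => ⟨fun i => M.1 i j, by
        have h : B * M.1 = 0 := M.2
        ext i
        exact congrFun (congrFun h i) j⟩
      map_add' := fun _ _ => rfl
      map_smul' := fun _ _ => rfl
      invFun := fun v => ⟨Matrix.of fun i j => (v j).1 i, by
        rw [LinearMap.mem_ker]
        ext i j
        exact congrFun (v j).2 i⟩
      left_inv := fun _ => rfl
      right_inv := fun _ => rfl }
  rw [E.finrank_eq, Module.finrank_pi_fintype, Finset.sum_const, Finset.card_univ, Fintype.card_fin,
    smul_eq_mul]

theorem charpoly_lmul_matrix {L : Type*} [Field L] {n : ℕ} (B : Matrix (Fin n) (Fin n) L) :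
    (Algebra.lmul L (Matrix (Fin n) (Fin n) L) B).charpoly = B.charpoly ^ n := by
  rw [← Matrix.charpoly_toLin' B, ← charpoly_pi_const]
  let E : Matrix (Fin n) (Fin n) L ≃ₗ[L] (Fin n → Fin n → L) := Matrix.transposeLinearEquiv _ _ L L
  rw [← LinearEquiv.charpoly_conj E]
  rfl

theorem Polynomial.Monic.eq_of_pow_eq_pow {L : Type*} [Field L] {p q : L[X]} (hp : p.Monic)
    (hq : q.Monic) {n : ℕ} (hn : n ≠ 0) (h : p ^ n = q ^ n) : p = q := by
  have h1 : p ∣ q := (UniqueFactorizationMonoid.pow_dvd_pow_iff_dvd hn).1 h.dvd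
  have h2 : q ∣ p := (UniqueFactorizationMonoid.pow_dvd_pow_iff_dvd hn).1 h.symm.dvd
  exact eq_of_monic_of_associated hp hq (associated_of_dvd_dvd h1 h2)

variable (D : Type*) [DivisionRing D] [FiniteDimensional (Subring.center D) D]

theorem finrank_center_eq_splittingDegree_sq :
    Module.finrank (Subring.center D) D = splittingDegree D * splittingDegree D := by
  have h := (splitting D).toLinearEquiv.finrank_eq
  rwa [Module.finrank_baseChange, Module.finrank_matrix, Module.finrank_self, mul_one,
    Fintype.card_fin] at h

theorem splittingDegree_pos : 0 < splittingDegree D := by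
  have h : 0 < Module.finrank (Subring.center D) D := Module.finrank_pos
  rw [finrank_center_eq_splittingDegree_sq] at h
  exact Nat.pos_of_mul_pos_left h

variable {D}

/-- The reduced characteristic polynomial of an element of `D`, with coefficients in an algebraic
closure of the center. -/
noncomputable def redCharpoly (a : D) : (AlgebraicClosure (Subring.center D))[X] :=
  (splitting D (1 ⊗ₜ a)).charpoly

theorem nrd_eq_coeff_redCharpoly (a : D) :
    nrd D a = (-1) ^ splittingDegree D * (redCharpoly a).coeff 0 := by
  refine (Matrix.det_eq_sign_charpoly_coeff _).trans ?_
  rw [Fintype.card_fin]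
  rfl

theorem redCharpoly_monic (a : D) : (redCharpoly a).Monic := Matrix.charpoly_monic _

theorem conj_splitting_baseChange_lmul (a : D) :
    (splitting D).toLinearEquiv.conj ((Algebra.lmul (Subring.center D) D a).baseChange
      (AlgebraicClosure (Subring.center D))) = Algebra.lmul _ _ (splitting D (1 ⊗ₜ a)) := by
  rw [Algebra.baseChange_lmul]
  refine LinearMap.ext fun M => ?_
  simp [LinearEquiv.conj_apply]

theorem redCharpoly_pow (a : D) :
    redCharpoly a ^ splittingDegree D =
      (Algebra.lmul (Subring.center D) D a).charpoly.map (algebraMap _ _) := by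
  rw [← LinearMap.charpoly_baseChange, ← LinearEquiv.charpoly_conj (splitting D).toLinearEquiv,
    conj_splitting_baseChange_lmul, charpoly_lmul_matrix]
  rfl

/-- The reduced characteristic polynomial is a power of the minimal polynomial `m` of `a`. Since
`charpoly(L_a) = m ^ t` with `t = [D : K(a)]`, this amounts to the splitting degree dividing `t`.
Now `t` is the dimension of the kernel of `L_a - α`, for `α` a root of `m`, and the kernel of left
multiplication by a matrix has a dimension divisible by the size of the matrix. -/
theorem exists_redCharpoly_eq_minpoly_pow (a : D) :
    ∃ k, redCharpoly a =
      (minpoly (Subring.center D) a ^ k).map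
        (algebraMap _ (AlgebraicClosure (Subring.center D))) := by
  have hint : IsIntegral (Subring.center D) a := Algebra.IsIntegral.isIntegral a
  obtain ⟨t, e, he⟩ := exists_equiv_adjoinRoot (K := Subring.center D) a
  obtain ⟨α, hα⟩ := IsAlgClosed.exists_aeval_eq_zero (AlgebraicClosure (Subring.center D))
    (minpoly (Subring.center D) a) (minpoly.degree_pos hint).ne'
  have h1 := finrank_ker_baseChange_lmul_sub e he hα
  set T := (Algebra.lmul (Subring.center D) D a).baseChange
    (AlgebraicClosure (Subring.center D)) - algebraMap _ _ α with hT
  have h2 : (splitting D).toLinearEquiv.conj T =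
      Algebra.lmul _ _ (splitting D (1 ⊗ₜ a) - algebraMap _ _ α) := by
    rw [hT, map_sub, conj_splitting_baseChange_lmul, map_sub]
    congr 1
    refine LinearMap.ext fun M => ?_
    rw [LinearEquiv.conj_apply_apply, Module.algebraMap_end_apply, map_smul,
      LinearEquiv.apply_symm_apply, Algebra.smul_def]
    rfl
  have h3 : Module.finrank (AlgebraicClosure (Subring.center D)) (LinearMap.ker T) =
      Module.finrank (AlgebraicClosure (Subring.center D))
        (LinearMap.ker ((splitting D).toLinearEquiv.conj T)) := by
    have e1 := T.finrank_range_add_finrank_ker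
    have e2 := ((splitting D).toLinearEquiv.conj T).finrank_range_add_finrank_ker
    have e3 : Module.finrank (AlgebraicClosure (Subring.center D)) (LinearMap.range T) =
        Module.finrank (AlgebraicClosure (Subring.center D))
          (LinearMap.range ((splitting D).toLinearEquiv.conj T)) := by
      rw [LinearEquiv.conj_apply, LinearMap.range_comp_of_range_eq_top _ (LinearEquiv.range _),
        LinearMap.range_comp]
      exact ((splitting D).toLinearEquiv.finrank_map_eq _).symm
    have e4 := (splitting D).toLinearEquiv.finrank_eq
    omega
  rw [h2, finrank_ker_lmul_matrix, h1] at h3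
  obtain ⟨k, hk⟩ : ∃ k, t = splittingDegree D * k := ⟨_, h3⟩
  refine ⟨k, Monic.eq_of_pow_eq_pow (redCharpoly_monic a) (((minpoly.monic hint).pow _).map _)
    (splittingDegree_pos D).ne' ?_⟩
  rw [redCharpoly_pow, charpoly_lmul_eq_minpoly_pow e he, hk, mul_comm, pow_mul,
    Polynomial.map_pow]

/-- The `n`-th power of the reduced norm is the determinant of left multiplication. -/
theorem nrd_pow (a : D) : nrd D a ^ splittingDegree D =
    algebraMap (Subring.center D) _ (LinearMap.det (Algebra.lmul (Subring.center D) D a)) := by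
  rw [LinearMap.det_eq_sign_charpoly_coeff, map_mul, map_pow, map_neg, map_one, ← coeff_map,
    ← redCharpoly_pow, nrd_eq_coeff_redCharpoly, mul_pow, ← pow_mul,
    finrank_center_eq_splittingDegree_sq, coeff_zero_eq_eval_zero, coeff_zero_eq_eval_zero,
    eval_pow]

/-- The reduced norm of a symmetric element is symmetric, because its minimal polynomial is. -/
theorem unitarySigma_le_unitarySigma' (τ : RingInvo D) : unitarySigma τ ≤ unitarySigma' τ := by
  refine (Subgroup.closure_le _).2 fun a ha => ?_
  have ha : τ.conj (a : D) = a := ha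
  have hint : IsIntegral (Subring.center D) (a : D) := Algebra.IsIntegral.isIntegral _
  obtain ⟨k, hk⟩ := exists_redCharpoly_eq_minpoly_pow (a : D)
  have hconj : ∀ p : (Subring.center D)[X],
      aeval (a : D) (p.map τ.centerConj) = τ.conj (aeval (a : D) p) := by
    intro p
    induction p using Polynomial.induction_on' with
    | add p q hp hq => simp [hp, hq]
    | monomial n c =>
      have h1 : ∀ m : ℕ, τ.conj ((a : D) ^ m) = (a : D) ^ m := fun m => by
        induction m with
        | zero => simp
        | succ m ih => rw [pow_succ, RingInvo.conj_mul, ih, ha, ← pow_succ', pow_succ]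
      rw [map_monomial, aeval_monomial, aeval_monomial, RingInvo.conj_mul, h1]
      exact (Subring.mem_center_iff.1 (τ.centerConj c).2 _).symm
  have hm : (minpoly (Subring.center D) (a : D)).map τ.centerConj =
      minpoly (Subring.center D) (a : D) := by
    refine (minpoly.unique _ _ ((minpoly.monic hint).map _) ?_ fun q hq h0 => ?_)
    · rw [hconj, minpoly.aeval, map_zero]
    · rw [degree_map]
      exact minpoly.min _ _ hq h0
  refine ⟨(-1) ^ splittingDegree D * (minpoly (Subring.center D) (a : D) ^ k).coeff 0, ?_, ?_⟩
  · have h2 : τ.centerConj ((minpoly (Subring.center D) (a : D) ^ k).coeff 0) =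
        (minpoly (Subring.center D) (a : D) ^ k).coeff 0 := by
      rw [← coeff_map, Polynomial.map_pow, hm]
    have h3 : τ.centerConj ((-1) ^ splittingDegree D *
        (minpoly (Subring.center D) (a : D) ^ k).coeff 0) = (-1) ^ splittingDegree D *
        (minpoly (Subring.center D) (a : D) ^ k).coeff 0 := by
      rw [map_mul, h2, map_pow, map_neg, map_one]
    exact congrArg Subtype.val h3
  · rw [nrd_eq_coeff_redCharpoly, hk, coeff_map, map_mul, map_pow, map_neg, map_one]

end ReducedCharpoly

/-! ### The reduced norm of the rational division algebra -/

section CentralMultiple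
variable {D : Type*} [DivisionRing D] [FiniteDimensional (Subring.center D) D]

/-- Every nonzero polynomial has a nonzero central multiple, since `D[x] / s D[x]` has finite
dimension over the center of `D`. -/
theorem exists_centralPoly_eq_mul {s : D[X]} (hs : s ≠ 0) :
    ∃ c, c ≠ 0 ∧ ∃ s', centralPoly c = s' * s := by
  let K := Subring.center D
  let S : Submodule K D[X] := LinearMap.range (LinearMap.mulLeft K s)
  let φ : (Fin s.natDegree → D) →ₗ[K] D[X] ⧸ S := S.mkQ ∘ₗ
    ∑ i : Fin s.natDegree, (monomial (R := D) i).restrictScalars K ∘ₗ LinearMap.proj i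
  have hφ : Function.Surjective φ := by
    intro q
    obtain ⟨f, rfl⟩ := S.mkQ_surjective q
    obtain ⟨a, r, hf, hlt⟩ := exists_eq_mul_add_degree_lt hs f
    refine ⟨fun i => r.coeff i, ?_⟩
    have hr : (∑ i : Fin s.natDegree, (monomial (R := D) i).restrictScalars K ∘ₗ
        LinearMap.proj i : (Fin s.natDegree → D) →ₗ[K] D[X]) (fun i => r.coeff i) = r := by
      simp only [LinearMap.sum_apply, LinearMap.comp_apply, LinearMap.proj_apply,
        LinearMap.restrictScalars_apply]
      rw [Fin.sum_univ_eq_sum_range (fun i => monomial i (r.coeff i))]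
      by_cases h0 : r = 0
      · simp [h0]
      · exact (as_sum_range' r _ ((natDegree_lt_natDegree_iff h0).2 hlt)).symm
    rw [LinearMap.comp_apply, hr, ← sub_eq_zero, ← map_sub, Submodule.mkQ_apply,
      Submodule.Quotient.mk_eq_zero]
    exact ⟨-a, by rw [LinearMap.mulLeft_apply, hf, mul_neg]; abel⟩
  have hfin : Module.Finite K (D[X] ⧸ S) := Module.Finite.of_surjective φ hφ
  let ψ : K[X] →ₗ[K] D[X] ⧸ S := S.mkQ ∘ₗ
    { toFun := centralPoly
      map_add' := map_add _
      map_smul' := fun k p => by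
        ext n
        simp only [coeff_centralPoly, coeff_smul, RingHom.id_apply]
        rfl }
  have hψ : ¬ Function.Injective ψ := fun h =>
    Polynomial.not_finite (Module.Finite.of_injective ψ h)
  rw [← LinearMap.ker_eq_bot, ← ne_eq, Submodule.ne_bot_iff] at hψ
  obtain ⟨c, hc, hc0⟩ := hψ
  obtain ⟨s', hs'⟩ := (Submodule.Quotient.mk_eq_zero S).1 hc
  exact ⟨c, hc0, s', centralPoly_eq_mul_comm hc0 (p := s) hs'.symm⟩

end CentralMultiple

namespace RatDiv
variable {D : Type*} [DivisionRing D]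

theorem extInvo_conj_ofPoly (τ : RingInvo D) (f : D[X]) :
    (extInvo τ).conj (ofPoly f) = ofPoly (τ.poly.conj f) :=
  congrArg MulOpposite.unop (invHom_ofPoly τ f)

theorem ofPoly_eq_zero {f : D[X]} : ofPoly f = 0 ↔ f = 0 :=
  map_eq_zero_iff _ ofPoly_injective

/-- The embedding of `K[x]` into the center of `D(x)`, where `K` is the center of `D`. -/
noncomputable def centralHom : (Subring.center D)[X] →+* Subring.center (RatDiv D) :=
  (ofPoly.comp centralPoly).codRestrict _ fun c =>
    ofPoly_mem_center (Subring.mem_center_iff.2 fun f => (centralPoly_mul_comm c f).symm)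

@[simp] theorem coe_centralHom (c : (Subring.center D)[X]) :
    (centralHom c : RatDiv D) = ofPoly (centralPoly c) := rfl

theorem centralHom_injective : Function.Injective (centralHom (D := D)) := fun _ _ h =>
  centralPoly_injective (ofPoly_injective (congrArg Subtype.val h))

theorem centerConj_centralHom (τ : RingInvo D) (c : (Subring.center D)[X]) :
    (extInvo τ).centerConj (centralHom c) = centralHom (c.map τ.centerConj) := by
  ext
  rw [RingInvo.coe_centerConj, coe_centralHom, coe_centralHom, extInvo_conj_ofPoly,
    RingInvo.poly_conj_centralPoly]

variable [FiniteDimensional (Subring.center D) D]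

theorem exists_centralHom_mul_eq (q : RatDiv D) :
    ∃ c, c ≠ 0 ∧ ∃ r,
      ((centralHom c : Subring.center (RatDiv D)) : RatDiv D) * q = ofPoly r := by
  obtain ⟨r, s, hs, rfl⟩ := exists_eq q
  obtain ⟨c, hc, s', hs'⟩ := exists_centralPoly_eq_mul hs
  refine ⟨c, hc, s' * r, ?_⟩
  rw [coe_centralHom, hs', map_mul, map_mul, mul_assoc,
    mul_inv_cancel_left₀ (mt ofPoly_eq_zero.1 hs)]

/-- The center of `D(x)` is the field of fractions of `K[x]`. -/
theorem exists_centralHom_mul_eq_centralHom (z : Subring.center (RatDiv D)) :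
    ∃ c, c ≠ 0 ∧ ∃ d, centralHom c * z = centralHom d := by
  obtain ⟨c, hc, r, hr⟩ := exists_centralHom_mul_eq (z : RatDiv D)
  obtain ⟨d, rfl⟩ : ∃ d, centralPoly d = r := exists_centralPoly_eq fun e => by
    apply ofPoly_injective
    rw [map_mul, map_mul, ← hr]
    exact Subring.mem_center_iff.1 (centralHom c * z).2 _
  exact ⟨c, hc, d, Subtype.ext hr⟩

variable {ι : Type*} [Fintype ι] (b : Module.Basis ι (Subring.center D) D)

theorem linearIndependent_ofPoly_C :
    LinearIndependent (Subring.center (RatDiv D)) fun i => ofPoly (C (b i)) := by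
  rw [Fintype.linearIndependent_iff]
  intro z hz
  choose c hc d hd using fun i => exists_centralHom_mul_eq_centralHom (z i)
  have hex : ∀ i, ∃ d', centralHom (∏ i, c i) * z i = centralHom d' := fun i => by
    obtain ⟨w, hw⟩ := Finset.dvd_prod_of_mem c (Finset.mem_univ i)
    exact ⟨w * d i, by rw [hw, mul_comm, map_mul, map_mul, ← hd]; ring⟩
  choose d' hd' using hex
  have h1 : ∑ i, centralPoly (d' i) * C (b i) = 0 := by
    apply ofPoly_injective
    rw [map_sum, map_zero]
    have := congrArg (fun q =>
      ((centralHom (∏ i, c i) : Subring.center (RatDiv D)) : RatDiv D) * q) hz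
    simp only [Finset.mul_sum, mul_zero] at this
    rw [← this]
    refine Finset.sum_congr rfl fun i _ => ?_
    rw [map_mul, ← coe_centralHom, ← hd', Subring.coe_mul, Subring.smul_def, smul_eq_mul,
      mul_assoc]
  have h2 : ∀ i, d' i = 0 := fun i => by
    ext1 n
    have h3 := congrArg (fun f => f.coeff n) h1
    simp only [finsetSum_coeff, coeff_mul_C, coeff_centralPoly, coeff_zero] at h3
    exact Fintype.linearIndependent_iff.1 b.linearIndependent (fun i => (d' i).coeff n) h3 i
  intro i
  have h4 := hd' i
  rw [h2, map_zero, mul_eq_zero] at h4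
  refine h4.resolve_left fun h => ?_
  rw [map_eq_zero_iff _ centralHom_injective] at h
  exact Finset.prod_ne_zero_iff.2 (fun i _ => hc i) h

theorem span_ofPoly_C :
    ⊤ ≤ Submodule.span (Subring.center (RatDiv D)) (Set.range fun i => ofPoly (C (b i))) := by
  set A := Submodule.span (Subring.center (RatDiv D)) (Set.range fun i => ofPoly (C (b i)))
  have hP : ∀ p, ofPoly p ∈ A := fun p => by
    induction p using Polynomial.induction_on' with
    | add p q hp hq => rw [map_add]; exact A.add_mem hp hq
    | monomial n a =>
      rw [← b.sum_repr a, map_sum, map_sum]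
      refine A.sum_mem fun i _ => ?_
      have : ofPoly (monomial n (b.repr a i • b i)) =
          centralHom (monomial n (b.repr a i)) • ofPoly (C (b i)) := by
        change _ = ofPoly (centralPoly _) * ofPoly (C (b i))
        rw [← map_mul]
        congr 1
        ext k
        rw [coeff_mul_C, coeff_centralPoly, coeff_monomial, coeff_monomial]
        split_ifs
        · rfl
        · simp
      rw [this]
      exact A.smul_mem _ (Submodule.subset_span ⟨i, rfl⟩)
  rintro q -
  obtain ⟨c, hc, r, hr⟩ := exists_centralHom_mul_eq q
  have hc0 : centralHom c ≠ 0 := by rwa [ne_eq, map_eq_zero_iff _ centralHom_injective]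
  have h1 : q = (centralHom c)⁻¹ • ofPoly r := by
    rw [← hr, ← smul_eq_mul, ← Subring.smul_def, inv_smul_smul₀ hc0]
  rw [h1]
  exact A.smul_mem _ (hP r)

/-- A basis of `D` over its center is a basis of `D(x)` over its center. -/
noncomputable def basis : Module.Basis ι (Subring.center (RatDiv D)) (RatDiv D) :=
  Module.Basis.mk (linearIndependent_ofPoly_C b) (span_ofPoly_C b)

theorem basis_apply (i : ι) : basis b i = ofPoly (C (b i)) := Module.Basis.mk_apply _ _ _

variable (D) in
theorem splittingDegree_eq : splittingDegree (RatDiv D) = splittingDegree D := by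
  have h1 := Module.finrank_eq_card_basis (basis (Module.finBasis (Subring.center D) D))
  rw [Fintype.card_fin, finrank_center_eq_splittingDegree_sq,
    finrank_center_eq_splittingDegree_sq] at h1
  exact Nat.mul_self_inj.1 h1

theorem leftMulMatrix_ofPoly [DecidableEq ι] (f : D[X]) :
    Algebra.leftMulMatrix (basis b) (ofPoly f) = centralHom.mapMatrix (regPoly b f) := by
  ext i k : 1
  rw [Algebra.leftMulMatrix_eq_repr_mul]
  have h1 : f * C (b k) = ∑ i, centralPoly (regPoly b f i k) * C (b i) := by
    ext n
    simp only [finsetSum_coeff, coeff_mul_C, coeff_centralPoly, coeff_regPoly,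
      Algebra.leftMulMatrix_eq_repr_mul]
    exact (b.sum_repr _).symm
  have h2 : ofPoly f * basis b k = ∑ i, centralHom (regPoly b f i k) • basis b i := by
    simp only [basis_apply, Subring.smul_def, smul_eq_mul, coe_centralHom, ← map_mul]
    rw [h1, map_sum]
  rw [h2, Module.Basis.repr_sum_self]
  rfl

theorem det_lmul_ofPoly [DecidableEq ι] (f : D[X]) :
    LinearMap.det (Algebra.lmul (Subring.center (RatDiv D)) (RatDiv D) (ofPoly f)) =
      centralHom (polyNorm b f) := by
  rw [← LinearMap.det_toMatrix (basis b), polyNorm_apply, RingHom.map_det, ← leftMulMatrix_ofPoly]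
  rfl

theorem charpoly_lmul_ofPoly_C (a : D) :
    (Algebra.lmul (Subring.center (RatDiv D)) (RatDiv D) (ofPoly (C a))).charpoly =
      (Algebra.lmul (Subring.center D) D a).charpoly.map (centralHom.comp C) := by
  let b := Module.finBasis (Subring.center D) D
  rw [← LinearMap.charpoly_toMatrix _ (basis b), ← LinearMap.charpoly_toMatrix _ b,
    ← Matrix.charpoly_map]
  congr 1
  refine (leftMulMatrix_ofPoly b (C a)).trans ?_
  ext i j : 1
  rw [RingHom.mapMatrix_apply, Matrix.map_apply, Matrix.map_apply, RingHom.comp_apply]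
  congr 1
  ext n : 1
  rw [coeff_regPoly, coeff_C, coeff_C]
  split_ifs
  · rfl
  · rw [map_zero]; rfl

/-- The reduced norm of an element of `D` does not change in `D(x)`. -/
theorem exists_nrd_eq (a : D) : ∃ c : Subring.center D, nrd D a = algebraMap _ _ c ∧
    nrd (RatDiv D) (ofPoly (C a)) = algebraMap _ _ (centralHom (C c)) := by
  obtain ⟨k, hk⟩ := exists_redCharpoly_eq_minpoly_pow a
  have hm : (minpoly (Subring.center D) a ^ k).Monic :=
    (minpoly.monic (Algebra.IsIntegral.isIntegral a)).pow k
  set P := minpoly (Subring.center D) a ^ k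
  have h1 : P ^ splittingDegree D = (Algebra.lmul (Subring.center D) D a).charpoly := by
    apply Polynomial.map_injective
      (algebraMap (Subring.center D) (AlgebraicClosure (Subring.center D)))
      (algebraMap (Subring.center D) _).injective
    rw [← redCharpoly_pow, hk, Polynomial.map_pow]
  have h2 : redCharpoly (ofPoly (C a)) =
      (P.map (centralHom.comp C)).map (algebraMap (Subring.center (RatDiv D)) _) := by
    refine Monic.eq_of_pow_eq_pow (redCharpoly_monic _) ((hm.map _).map _)
      (splittingDegree_pos (RatDiv D)).ne' ?_
    rw [redCharpoly_pow, charpoly_lmul_ofPoly_C, ← h1, splittingDegree_eq, Polynomial.map_pow,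
      Polynomial.map_pow]
  refine ⟨(-1) ^ splittingDegree D * P.coeff 0, ?_, ?_⟩
  · rw [nrd_eq_coeff_redCharpoly, hk, coeff_map, map_mul, map_pow, map_neg, map_one]
  · rw [nrd_eq_coeff_redCharpoly, h2, coeff_map, coeff_map, splittingDegree_eq]
    simp

theorem ofPoly_C_mem_unitarySigma'_iff (τ : RingInvo D) (a : Dˣ) :
    Units.map ((ofPoly.comp C : D →+* RatDiv D) : D →* RatDiv D) a ∈ unitarySigma' (extInvo τ) ↔
      a ∈ unitarySigma' τ := by
  obtain ⟨c, hc, hc'⟩ := exists_nrd_eq (a : D)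
  have hconj : (extInvo τ).centerConj (centralHom (C c)) = centralHom (C (τ.centerConj c)) := by
    rw [centerConj_centralHom, map_C]
  constructor
  · rintro ⟨z, hz, hz'⟩
    have h1 : z = centralHom (C c) := (algebraMap (Subring.center (RatDiv D))
      (AlgebraicClosure (Subring.center (RatDiv D)))).injective (hz'.trans hc')
    have h2 : (extInvo τ).centerConj z = z := Subtype.ext hz
    rw [h1, hconj] at h2
    exact ⟨c, congrArg Subtype.val (C_injective (centralHom_injective h2)), hc.symm⟩
  · rintro ⟨z, hz, hz'⟩
    have h1 : z = c := (algebraMap (Subring.center D)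
      (AlgebraicClosure (Subring.center D))).injective (hz'.trans hc)
    have h2 : τ.centerConj c = c := by rw [← h1]; exact Subtype.ext hz
    rw [h2] at hconj
    exact ⟨_, congrArg Subtype.val hconj, hc'.symm⟩

/-- The norm of a polynomial is symmetric if its reduced norm is. -/
theorem polyNorm_symmetric [DecidableEq ι] (τ : RingInvo D) {f : D[X]} (u : (RatDiv D)ˣ)
    (hu : (u : RatDiv D) = ofPoly f) (h : u ∈ unitarySigma' (extInvo τ)) :
    (polyNorm b f).map τ.centerConj = polyNorm b f := by
  obtain ⟨z, hz, hz'⟩ := h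
  have hz : (extInvo τ).centerConj z = z := Subtype.ext hz
  have h1 : z ^ splittingDegree (RatDiv D) = centralHom (polyNorm b f) := by
    apply (algebraMap (Subring.center (RatDiv D))
      (AlgebraicClosure (Subring.center (RatDiv D)))).injective
    rw [map_pow, hz', hu, nrd_pow, det_lmul_ofPoly b]
  apply centralHom_injective
  rw [← centerConj_centralHom, ← h1, map_pow, hz]

end RatDiv

/-! ### Stability of the unitary `SK₁` -/

namespace RatDiv
variable {D : Type*} [DivisionRing D]

/-- The multiplicative map `D(x) → D` sending `s⁻¹ r` to the quotient of the leading coefficients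
of `s` and `r`. -/
noncomputable def leadHom : RatDiv D →* D :=
  OreLocalization.universalMulHom (leadingCoeffHom : D[X] →* D)
    (IsUnit.liftRight ((leadingCoeffHom : D[X] →* D).comp (D[X]⁰).subtype) fun s =>
      isUnit_iff_ne_zero.2 (leadingCoeff_ne_zero.2 (nonZeroDivisors.ne_zero s.2)))
    fun _ => rfl

theorem leadHom_ofPoly (f : D[X]) : leadHom (ofPoly f) = f.leadingCoeff :=
  OreLocalization.universalMulHom_commutes _ _ _

theorem leadHom_conj (τ : RingInvo D) (q : RatDiv D) :
    leadHom ((extInvo τ).conj q) = τ.conj (leadHom q) := by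
  obtain ⟨r, s, hs, hq⟩ := exists_eq q
  have h1 : ofPoly s * q = ofPoly r := by
    rw [hq, mul_inv_cancel_left₀ (mt ofPoly_eq_zero.1 hs)]
  have h2 := congrArg leadHom (congrArg (extInvo τ).conj h1)
  have h3 := congrArg τ.conj (congrArg leadHom h1)
  rw [RingInvo.conj_mul, extInvo_conj_ofPoly, extInvo_conj_ofPoly, map_mul, leadHom_ofPoly,
    leadHom_ofPoly, RingInvo.leadingCoeff_poly_conj, RingInvo.leadingCoeff_poly_conj] at h2
  rw [map_mul, leadHom_ofPoly, leadHom_ofPoly, RingInvo.conj_mul] at h3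
  refine mul_right_cancel₀ (b := τ.conj s.leadingCoeff) (fun h => ?_) (h2.trans h3.symm)
  have h4 := τ.conj_conj s.leadingCoeff
  rw [h, map_zero] at h4
  exact leadingCoeff_ne_zero.2 hs h4.symm

/-- The embedding `D* → D(x)*`. -/
noncomputable def unitsHom : Dˣ →* (RatDiv D)ˣ :=
  Units.map ((ofPoly.comp C : D →+* RatDiv D) : D →* RatDiv D)

@[simp] theorem coe_unitsHom (a : Dˣ) : (unitsHom a : RatDiv D) = ofPoly (C (a : D)) := rfl

/-- The leading coefficient retracts `D(x)*` onto `D*` and preserves symmetric elements. -/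
theorem unitsHom_mem_unitarySigma_iff (τ : RingInvo D) (a : Dˣ) :
    unitsHom a ∈ unitarySigma (extInvo τ) ↔ a ∈ unitarySigma τ := by
  constructor
  · intro h
    have h1 : unitarySigma (extInvo τ) ≤ (unitarySigma τ).comap (Units.map leadHom) := by
      refine (Subgroup.closure_le _).2 fun u hu => Subgroup.subset_closure ?_
      have hu : (extInvo τ).conj (u : RatDiv D) = u := hu
      change τ.conj (leadHom (u : RatDiv D)) = leadHom (u : RatDiv D)
      rw [← leadHom_conj, hu]
    have h2 : Units.map leadHom (unitsHom a) = a := by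
      ext
      rw [Units.coe_map, coe_unitsHom, leadHom_ofPoly, leadingCoeff_C]
    rw [← h2]
    exact h1 h
  · intro h
    have h1 : unitarySigma τ ≤ (unitarySigma (extInvo τ)).comap unitsHom := by
      refine (Subgroup.closure_le _).2 fun u hu => Subgroup.subset_closure ?_
      have hu : τ.conj (u : D) = u := hu
      change (extInvo τ).conj (ofPoly (C (u : D))) = ofPoly (C (u : D))
      rw [extInvo_conj_ofPoly, RingInvo.poly_conj_C, hu]
    exact h1 h

variable [FiniteDimensional (Subring.center D) D]

/-- Modulo products of symmetric elements, every element of `D(x)*` with symmetric reduced norm is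
a constant: a polynomial of least degree in its class is constant. -/
theorem exists_unitsHom_mk_eq {τ : RingInvo D} (hτ : τ.IsUnitary) {u : (RatDiv D)ˣ}
    (hu : u ∈ unitarySigma' (extInvo τ)) :
    ∃ d : Dˣ, (unitsHom d : (RatDiv D)ˣ ⧸ unitarySigma (extInvo τ)) = u := by
  classical
  let _ : CommGroup ((RatDiv D)ˣ ⧸ unitarySigma (extInvo τ)) :=
    { (inferInstance : Group ((RatDiv D)ˣ ⧸ unitarySigma (extInvo τ))) with
      mul_comm := fun p q => by
        induction p using QuotientGroup.induction_on
        induction q using QuotientGroup.induction_on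
        exact (extInvo τ).unitarySigma_mk_comm (extInvo_unitary hτ) _ _ }
  let θ : RatDiv D →*₀ WithZero ((RatDiv D)ˣ ⧸ unitarySigma (extInvo τ)) :=
    (WithZero.map' (QuotientGroup.mk' (unitarySigma (extInvo τ)))).comp
      (WithZero.withZeroUnitsEquiv (G := RatDiv D)).symm.toMonoidWithZeroHom
  have hθ : ∀ v : (RatDiv D)ˣ,
      θ v = ((v : (RatDiv D)ˣ ⧸ unitarySigma (extInvo τ)) : WithZero _) := fun v => by
    change WithZero.map' _ (WithZero.withZeroUnitsEquiv.symm (v : RatDiv D)) = _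
    rw [WithZero.withZeroUnitsEquiv_symm_apply_coe]
    rfl
  have hsym : ∀ s : D[X], s ≠ 0 → τ.poly.conj s = s → θ (ofPoly s) = 1 := fun s h0 hs => by
    have h1 : ofPoly s ≠ 0 := mt ofPoly_eq_zero.1 h0
    rw [← Units.val_mk0 h1, hθ, ← WithZero.coe_one, WithZero.coe_inj, QuotientGroup.eq_one_iff]
    refine Subgroup.subset_closure ?_
    change (extInvo τ).conj (ofPoly s) = ofPoly s
    rw [extInvo_conj_ofPoly, hs]
  obtain ⟨f₀, hf₀, hf₀u⟩ : ∃ f : D[X], f ≠ 0 ∧ θ (ofPoly f) = θ u := by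
    obtain ⟨r, s, hs, hq⟩ := exists_eq (u : RatDiv D)
    have hr : r ≠ 0 := by
      rintro rfl
      rw [map_zero, mul_zero] at hq
      exact u.ne_zero hq
    have hs' : τ.poly.conj s ≠ 0 := by simpa using hs
    refine ⟨τ.poly.conj s * r, mul_ne_zero hs' hr, ?_⟩
    have h1 : θ (ofPoly s) * θ (ofPoly (τ.poly.conj s)) = 1 := by
      rw [← map_mul, ← map_mul]
      exact hsym _ (mul_ne_zero hs hs') (by simp)
    rw [hq, map_mul, map_mul, map_mul, map_inv₀, eq_inv_of_mul_eq_one_right h1]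
  obtain ⟨f, ⟨hf, hfu⟩, hmin⟩ := WellFounded.has_min (measure (natDegree (R := D))).wf
    {f : D[X] | f ≠ 0 ∧ θ (ofPoly f) = θ u} ⟨f₀, hf₀, hf₀u⟩
  have hf0 : ofPoly f ≠ 0 := mt ofPoly_eq_zero.1 hf
  have hfu' : ((Units.mk0 _ hf0 : (RatDiv D)ˣ) : (RatDiv D)ˣ ⧸ unitarySigma (extInvo τ)) = u := by
    rwa [← Units.val_mk0 hf0, hθ, hθ, WithZero.coe_inj] at hfu
  have hfd : f.natDegree = 0 := by
    by_contra hfd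
    have hmem : Units.mk0 _ hf0 ∈ unitarySigma' (extInvo τ) := by
      have h1 := unitarySigma_le_unitarySigma' _ (QuotientGroup.eq.1 hfu')
      have h2 := mul_mem hu (inv_mem h1)
      simpa using h2
    have hN := polyNorm_symmetric (Module.finBasis (Subring.center D) D) τ _ (Units.val_mk0 hf0)
      hmem
    obtain ⟨g, hg, hgd, hgf⟩ := exists_natDegree_lt_of_symmetric_polyNorm _ hτ
      (θ.comp (ofPoly (D := D)).toMonoidWithZeroHom)
      (fun p hp => (map_ne_zero θ).2 (mt ofPoly_eq_zero.1 hp)) hsym (Nat.pos_of_ne_zero hfd) hN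
    exact hmin g ⟨hg, Eq.trans hgf hfu⟩ hgd
  obtain ⟨d, rfl⟩ := natDegree_eq_zero.1 hfd
  have hd : d ≠ 0 := fun h => hf (by rw [h, C_0])
  refine ⟨Units.mk0 d hd, ?_⟩
  rw [← hfu']
  congr 1
  ext
  rfl

/-- The embedding `Σ'_τ(D) → Σ'_τ'(D(x))`. -/
noncomputable def unitarySigma'Hom (τ : RingInvo D) :
    unitarySigma' τ →* unitarySigma' (extInvo τ) :=
  (unitsHom.comp (unitarySigma' τ).subtype).codRestrict _ fun a =>
    (ofPoly_C_mem_unitarySigma'_iff τ (a : Dˣ)).2 a.2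

end RatDiv

theorem mainTheorem2 {D : Type*} [DivisionRing D] [FiniteDimensional (Subring.center D) D]
    (τ : RingInvo D) (hτ : τ.IsUnitary) :
    Nonempty (UnitarySK1 τ ≃* UnitarySK1 (RatDiv.extInvo τ)) := by
  have hmem : ∀ a : unitarySigma' τ,
      RatDiv.unitarySigma'Hom τ a ∈ (unitarySigma (RatDiv.extInvo τ)).subgroupOf _ ↔
        a ∈ (unitarySigma τ).subgroupOf (unitarySigma' τ) := fun a =>
    RatDiv.unitsHom_mem_unitarySigma_iff τ (a : Dˣ)
  have hle : (unitarySigma τ).subgroupOf (unitarySigma' τ) ≤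
      ((unitarySigma (RatDiv.extInvo τ)).subgroupOf _).comap (RatDiv.unitarySigma'Hom τ) :=
    fun a ha => (hmem a).2 ha
  refine ⟨MulEquiv.ofBijective (QuotientGroup.map _ _ (RatDiv.unitarySigma'Hom τ) hle) ⟨?_, ?_⟩⟩
  · rw [injective_iff_map_eq_one]
    intro q hq
    induction q using QuotientGroup.induction_on with | _ a
    rw [QuotientGroup.map_mk, QuotientGroup.eq_one_iff] at hq
    exact (QuotientGroup.eq_one_iff _).2 ((hmem a).1 hq)
  · intro q
    induction q using QuotientGroup.induction_on with | _ u
    obtain ⟨d, hd⟩ := RatDiv.exists_unitsHom_mk_eq hτ u.2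
    have h1 := QuotientGroup.eq.1 hd
    have h2 : RatDiv.unitsHom d ∈ unitarySigma' (RatDiv.extInvo τ) := by
      have := mul_mem u.2 (inv_mem (unitarySigma_le_unitarySigma' _ h1))
      simpa using this
    refine ⟨((⟨d, (RatDiv.ofPoly_C_mem_unitarySigma'_iff τ d).1 h2⟩ : unitarySigma' τ) :
      UnitarySK1 τ), ?_⟩
    rw [QuotientGroup.map_mk]
    exact QuotientGroup.eq.2 h1
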